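/- Let $K$ be a perfect field, let $n\ge 0$ and $P=K[X_0,\dots,X_n]$. Let $\mathbb{X}$ be a 0-dimensional closed subscheme of $\mathbb{P}^n_K$ with saturated homogeneous vanishing ideal $I_{\mathbb{X}}\subseteq P$ (so $\dim P/I_{\mathbb{X}}=1$) and homogeneous coordinate ring $R=P/I_{\mathbb{X}}$. Let $\mathbb{Y}$ be the differential fattening of $\mathbb{X}$, that is, the 0-dimensional scheme whose saturated homogeneous vanishing ideal is $$I_{\mathbb{Y}}=\{f\in P \mid \delta(f)\in I_{\mathbb{X}} \text{ for every } K\text{-linear differential operator } \delta \text{ of } P \text{ of order at most } 1\}.$$ Let $\Omega^1_R$ be the module of Kähler differentials of $R/K$, graded so that $\deg(f\,dg)=\deg f+\deg g$ for homogeneous $f,g\in R$. For a finitely generated graded $R$-module $M$, let $\mathrm{HF}_M(i)=\dim_K M_i$ $(i\in\mathbb{Z})$ be its Hilbert function, $\mathrm{HP}(M)$ its Hilbert polynomial, and $\mathrm{ri}(M)$ its regularity index, i.e. the least $i\in\mathbb{Z}$ such that $\mathrm{HF}_M(j)=\mathrm{HP}(M)(j)$ for all $j\ge i$. Write $\mathrm{HF}_{\mathbb{X}}=\mathrm{HF}_R$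 and $r_{\mathbb{X}}=\mathrm{ri}(R)$, let $\deg\mathbb{X}$ be the value of the constant polynomial $\mathrm{HP}(R)$, and define $\mathrm{HF}_{\mathbb{Y}}, r_{\mathbb{Y}},\deg\mathbb{Y}$ in the same way from $P/I_{\mathbb{Y}}$. All these Hilbert polynomials and regularity indices exist, and the following holds. (a) For all $i\in\mathbb{N}$, $$\mathrm{HF}_{\Omega^1_R}(i)=(n+1)\,\mathrm{HF}_{\mathbb{X}}(i-1)+\mathrm{HF}_{\mathbb{X}}(i)-\mathrm{HF}_{\mathbb{Y}}(i).$$ In particular $\mathrm{HP}(\Omega^1_R)=(n+2)\deg\mathbb{X}-\deg\mathbb{Y}$ and $\mathrm{ri}(\Omega^1_R)\le\max\{r_{\mathbb{X}}+1,\,r_{\mathbb{Y}}\}$. (b) Let $p\ge 0$ be the characteristic of $K$, and suppose that $\mathbb{X}=m_1p_1+\cdots+m_sp_s$ is a fat point scheme: $p_1,\dots,p_s$ are distinct $K$-rational points of $\mathbb{P}^n_K$ with homogeneous vanishing ideals $I_{p_j}$, the $m_j$ are positive integers, and $I_{\mathbb{X}}=I_{p_1}^{m_1}\cap\cdots\cap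 I_{p_s}^{m_s}$. (i) We have $$\mathrm{HP}(\Omega^1_R)=\sum_{j=1}^s\left[(n+2)\binom{m_j+n-1}{n}-\binom{m_j+n}{n}\right]+\sum_{p\mid m_j}\#\Big\{(\alpha_1,\dots,\alpha_n)\in\mathbb{N}^n \;\Big|\; \sum_{i=1}^n\alpha_i=\frac{m_j}{p}\Big\},$$ where the second sum runs over all $j\in\{1,\dots,s\}$ with $p\mid m_j$ (it is empty if $p=0$). (ii) If $n\ge 1$, then $m_1=\cdots=m_s=1$ if and only if $\mathrm{HP}(\Omega^1_R)=s$. -/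

import Mathlib

noncomputable section

/-! ### Differential operators and differential powers -/

/-- `IsDiffOp K R m δ`: the `K`-linear map `δ : R → R` is a `K`-linear differential operator of order
at most `m`. Operators of order at most `0` are the `R`-linear maps, and `δ` has order at most
`m + 1` when every commutator `[δ, f] = δ ∘ μ_f - μ_f ∘ δ` has order at most `m`, where `μ_f` is
multiplication by `f`. -/
def IsDiffOp (K R : Type*) [CommRing K] [CommRing R] [Algebra K R] : ℕ → (R →ₗ[K] R) → Prop
  | 0, δ => ∀ f g : R, δ (f * g) = f * δ g
  | m + 1, δ => ∀ f : R,
      IsDiffOp K R m (δ ∘ₗ LinearMap.mulLeft K f - LinearMap.mulLeft K f ∘ₗ δ)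

theorem IsDiffOp.comp_mulLeft {K R : Type*} [CommRing K] [CommRing R] [Algebra K R] (m : ℕ)
    (δ : R →ₗ[K] R) (h : IsDiffOp K R m δ) (a : R) :
    IsDiffOp K R m (δ ∘ₗ LinearMap.mulLeft K a) := by
  induction m generalizing δ with
  | zero =>
    intro f g
    simp only [LinearMap.comp_apply, LinearMap.mulLeft_apply]
    rw [mul_left_comm, h]
  | succ m ih =>
    intro f
    have := ih _ (h f)
    convert this using 1
    ext g
    simp [mul_left_comm]

/-- The `m`-th `K`-linear differential power `J^⟨m⟩` of an ideal `J` of `R`, for `m ≥ 1`: the ideal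
of all `f` such that `δ f ∈ J` for every differential operator `δ` of order at most `m - 1`. -/
def diffPower (K : Type*) {R : Type*} [CommRing K] [CommRing R] [Algebra K R]
    (J : Ideal R) (m : ℕ) : Ideal R where
  carrier := {f | ∀ δ : R →ₗ[K] R, IsDiffOp K R (m - 1) δ → δ f ∈ J}
  add_mem' {f g} hf hg δ hδ := by
    rw [map_add]
    exact J.add_mem (hf δ hδ) (hg δ hδ)
  zero_mem' δ _ := by simp
  smul_mem' a f hf δ hδ := by
    have := hf _ (hδ.comp_mulLeft _ _ a)
    simpa using this

/-! ### Zero-dimensional schemes in projective space -/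

/-- A zero-dimensional closed subscheme of `ℙⁿ` over `K`, given by its saturated homogeneous
vanishing ideal in `P = K[X_0, …, X_n]`. Its homogeneous coordinate ring is one-dimensional. -/
structure ZeroDimScheme (K : Type*) [Field K] (n : ℕ) where
  /-- The homogeneous vanishing ideal of the scheme. -/
  ideal : Ideal (MvPolynomial (Fin (n + 1)) K)
  homogeneous : ∀ f ∈ ideal, ∀ d : ℕ, MvPolynomial.homogeneousComponent d f ∈ ideal
  saturated : ∀ f, (∀ i, MvPolynomial.X i * f ∈ ideal) → f ∈ ideal
  dim_eq_one : ringKrullDim (MvPolynomial (Fin (n + 1)) K ⧸ ideal) = 1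

theorem mem_diffPower_two_iff {K : Type*} [Field K] {n : ℕ}
    (I : Ideal (MvPolynomial (Fin (n + 1)) K)) (f : MvPolynomial (Fin (n + 1)) K) :
    f ∈ diffPower K I 2 ↔ f ∈ I ∧ ∀ i, MvPolynomial.pderiv i f ∈ I := by
  constructor
  · intro h
    refine ⟨?_, fun i => ?_⟩
    · refine h LinearMap.id ?_
      intro a b c
      simp
    · refine h (MvPolynomial.pderiv i).toLinearMap ?_
      intro a b c
      simp
      ring
  · rintro ⟨h0, h1⟩ δ hδ
    have key : ∀ a g, δ (a * g) = a * δ g + g * δ a - a * g * δ 1 := by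
      intro a g
      have h2 := hδ a g 1
      simp at h2
      linear_combination h2
    let E : Derivation K (MvPolynomial (Fin (n + 1)) K) (MvPolynomial (Fin (n + 1)) K) :=
      Derivation.mk' (δ - LinearMap.mulRight K (δ 1)) (by
        intro a b
        simp [key a b]
        ring)
    have hsum : ∀ (D : Fin (n + 1) → Derivation K (MvPolynomial (Fin (n + 1)) K)
        (MvPolynomial (Fin (n + 1)) K)) g, (∑ i, D i) g = ∑ i, D i g := by
      intro D g
      have := congrFun (map_sum (Derivation.coeFnAddMonoidHom (R := K)
        (A := MvPolynomial (Fin (n + 1)) K) (M := MvPolynomial (Fin (n + 1)) K)) D Finset.univ) g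
      rw [Finset.sum_apply] at this
      exact this
    have hE : E = ∑ i, E (MvPolynomial.X i) • MvPolynomial.pderiv i := by
      apply MvPolynomial.derivation_ext
      intro j
      rw [hsum]
      simp [MvPolynomial.pderiv_X, Pi.single_apply]
    have hf : δ f = E f + f * δ 1 := by
      simp [E]
    rw [hf, hE, hsum]
    refine I.add_mem (I.sum_mem fun i _ => ?_) (I.mul_mem_right _ h0)
    exact I.mul_mem_left _ (h1 i)

theorem homogeneousComponent_pderiv {K : Type*} [Field K] {n : ℕ}
    (f : MvPolynomial (Fin (n + 1)) K) (i : Fin (n + 1)) (d : ℕ) :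
    MvPolynomial.homogeneousComponent d (MvPolynomial.pderiv i f) =
      MvPolynomial.pderiv i (MvPolynomial.homogeneousComponent (d + 1) f) := by
  ext e
  simp only [MvPolynomial.coeff_homogeneousComponent, MvPolynomial.coeff_pderiv]
  simp

/-- The differential fattening `𝕐` of `𝕏`: the zero-dimensional scheme whose vanishing ideal is the
second differential power `I_𝕏^⟨2⟩` of the vanishing ideal of `𝕏`. -/
def ZeroDimScheme.diffFattening {K : Type*} [Field K] {n : ℕ} (X : ZeroDimScheme K n) :
    ZeroDimScheme K n where
  ideal := diffPower K X.ideal 2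
  homogeneous f hf d := by
    rw [mem_diffPower_two_iff] at hf ⊢
    refine ⟨X.homogeneous f hf.1 d, fun i => ?_⟩
    cases d with
    | zero => simp
    | succ d =>
      rw [← homogeneousComponent_pderiv]
      exact X.homogeneous _ (hf.2 i) d
  saturated f hf := by
    simp only [mem_diffPower_two_iff] at hf ⊢
    have h0 : f ∈ X.ideal := X.saturated f fun i => (hf i).1
    refine ⟨h0, fun j => X.saturated _ fun i => ?_⟩
    have h1 := (hf i).2 j
    rw [MvPolynomial.pderiv_mul] at h1
    exact (X.ideal.add_mem_iff_right (X.ideal.mul_mem_left _ h0)).1 h1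
  dim_eq_one := by
    rw [← X.dim_eq_one, ringKrullDim_quotient, ringKrullDim_quotient]
    have h1 : diffPower K X.ideal 2 ≤ X.ideal := fun f hf =>
      ((mem_diffPower_two_iff _ _).1 hf).1
    have h2 : X.ideal ^ 2 ≤ diffPower K X.ideal 2 := by
      rw [pow_two, Ideal.mul_le]
      intro a ha b hb
      rw [mem_diffPower_two_iff]
      refine ⟨X.ideal.mul_mem_left _ hb, fun i => ?_⟩
      rw [MvPolynomial.pderiv_mul]
      exact X.ideal.add_mem (X.ideal.mul_mem_left _ hb) (X.ideal.mul_mem_right _ ha)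
    have h3 : PrimeSpectrum.zeroLocus (diffPower K X.ideal 2 : Set _) =
        PrimeSpectrum.zeroLocus (X.ideal : Set (MvPolynomial (Fin (n + 1)) K)) := by
      apply le_antisymm
      · rw [← PrimeSpectrum.zeroLocus_pow X.ideal two_ne_zero]
        exact PrimeSpectrum.zeroLocus_anti_mono h2
      · exact PrimeSpectrum.zeroLocus_anti_mono h1
    rw [h3]

/-! ### Hilbert functions -/

/-- The Hilbert function `i ↦ dim_K M_i` of a graded module given by its homogeneous components. -/
def hilbertFun {K M : Type*} [Field K] [AddCommGroup M] [Module K M]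
    (ℳ : ℤ → Submodule K M) (i : ℤ) : ℤ :=
  Module.finrank K (ℳ i)

/-- `q` is a Hilbert polynomial of `F`: it agrees with `F` at all large integers. -/
def IsHilbertPoly (F : ℤ → ℤ) (q : Polynomial ℚ) : Prop :=
  ∃ N : ℤ, ∀ i ≥ N, (F i : ℚ) = q.eval (i : ℚ)

open Classical in
/-- The Hilbert polynomial of `F` (unique if it exists, and `0` if there is none). -/
def hilbertPoly (F : ℤ → ℤ) : Polynomial ℚ :=
  if h : ∃ q, IsHilbertPoly F q then h.choose else 0

/-- The integers from which on `F` agrees with its Hilbert polynomial. -/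
def regularitySet (F : ℤ → ℤ) : Set ℤ :=
  {i | ∀ j ≥ i, (F j : ℚ) = (hilbertPoly F).eval (j : ℚ)}

/-- The regularity index of `F`: the least element of `regularitySet F`. -/
def regularityIndex (F : ℤ → ℤ) : ℤ := sInf (regularitySet F)

namespace ZeroDimScheme

variable {K : Type*} [Field K] {n : ℕ} (X : ZeroDimScheme K n)

/-- The homogeneous coordinate ring `R = P / I_𝕏`. -/
abbrev coordRing : Type _ := MvPolynomial (Fin (n + 1)) K ⧸ X.ideal

/-- The homogeneous component `R_i` of the homogeneous coordinate ring: the image of the forms of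
degree `i`, which is zero for `i < 0`. -/
def coordComponent : ℤ → Submodule K X.coordRing
  | Int.ofNat d => (MvPolynomial.homogeneousSubmodule (Fin (n + 1)) K d).map
      (Ideal.Quotient.mkₐ K X.ideal).toLinearMap
  | Int.negSucc _ => ⊥

/-- The homogeneous component of degree `i` of `Ω¹_R`, the module of Kähler differentials of `R / K`
with the grading induced from that of `R`: it is spanned by the `f dg` with `f`, `g` homogeneous and
`deg f + deg g = i`; in particular `deg (dx_j) = 1`. -/
def kaehlerComponent (i : ℤ) : Submodule K (KaehlerDifferential K X.coordRing) :=
  Submodule.span K {ω | ∃ a b : ℤ, a + b = i ∧ ∃ f ∈ X.coordComponent a, ∃ g ∈ X.coordComponent b,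
    ω = f • KaehlerDifferential.D K X.coordRing g}

/-- The Hilbert function `HF_𝕏 = HF_R` of the scheme. -/
def HF : ℤ → ℤ := hilbertFun X.coordComponent

/-- The Hilbert function of `Ω¹_R`. -/
def HFOmega : ℤ → ℤ := hilbertFun X.kaehlerComponent

/-- The degree of the scheme: its Hilbert polynomial is a constant, and the degree is its value. -/
def degree : ℚ := (hilbertPoly X.HF).coeff 0

end ZeroDimScheme

/-- The homogeneous vanishing ideal of a `K`-rational point of `ℙⁿ`: the ideal generated by the
homogeneous polynomials that vanish at the point. -/
def pointIdeal {K : Type*} [Field K] {n : ℕ} (q : Projectivization K (Fin (n + 1) → K)) :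
    Ideal (MvPolynomial (Fin (n + 1)) K) :=
  Ideal.span {f | (∃ d : ℕ, f.IsHomogeneous d) ∧ MvPolynomial.eval q.rep f = 0}

/-- `X` is the fat point scheme `m_1 q_1 + ⋯ + m_s q_s`, for distinct `K`-rational points `q_j` and
multiplicities `m_j ≥ 1`: its vanishing ideal is the intersection of the powers of the vanishing
ideals of the points. -/
structure IsFatPointScheme {K : Type*} [Field K] {n s : ℕ} (X : ZeroDimScheme K n)
    (q : Fin s → Projectivization K (Fin (n + 1) → K)) (m : Fin s → ℕ) : Prop where
  distinct : Function.Injective q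
  pos : ∀ j, 1 ≤ m j
  ideal_eq : X.ideal = ⨅ j, pointIdeal (q j) ^ m j

end

/-! Write `𝔪` for the irrelevant ideal, `I_X ⊇ I_Y` for the ideals of `𝕏` and of its fattening `𝕐`.
The ideal `I_Y` consists of the `f ∈ I_X` whose gradient vanishes modulo `I_X`, so in each degree
the sequence `0 → (I_Y)_{d+1} → (I_X)_{d+1} → R_d^{n+1} → (Ω¹_R)_{d+1} → 0` is exact, which gives
the Hilbert function of `Ω¹_R`.

Since `I_X` is saturated, multiplication by `∑ t^k x_k` is injective on `R[t]`, so the Hilbert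
function of `R` is nondecreasing; Noether normalization bounds its partial sums linearly, because
`R` has dimension `1`. Hence it is eventually constant.

For fat points, any two of the ideals in the intersection have a sum containing a power of `𝔪`, so
by the Chinese remainder theorem the degrees add up over the points. A linear change of coordinates
moves a point to a coordinate point, where the ideals are spanned by monomials to be counted. The
characteristic `p` enters through the monomials `x^(pα)`, all of whose derivatives vanish.
-/

noncomputable section

open MvPolynomial Module Filter

attribute [local instance] MvPolynomial.gradedAlgebra

theorem finrank_map_add_finrank_inf_ker {K V W : Type*} [DivisionRing K] [AddCommGroup V]
    [Module K V] [AddCommGroup W] [Module K W] (f : V →ₗ[K] W) (p : Submodule K V)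
    [FiniteDimensional K p] :
    finrank K (p.map f) + finrank K ↥(p ⊓ f.ker) = finrank K p := by
  rw [← (f.domRestrict p).finrank_range_add_finrank_ker, LinearMap.range_domRestrict,
    LinearMap.ker_domRestrict, ← Submodule.finrank_map_subtype_eq p (f.ker.comap p.subtype),
    Submodule.map_comap_subtype]

section GradedPieces

variable {K σ : Type*} [Field K]

/-- The space `J_d` of forms of degree `d` in the ideal `J`. -/
def idealComponent (J : Ideal (MvPolynomial σ K)) (d : ℕ) : Submodule K (MvPolynomial σ K) :=
  homogeneousSubmodule σ K d ⊓ J.restrictScalars K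

/-- The space `(P / J)_d`, where `P` is the polynomial ring: the image of the forms of
degree `d`. -/
def quotComponent (J : Ideal (MvPolynomial σ K)) (d : ℕ) : Submodule K (MvPolynomial σ K ⧸ J) :=
  (homogeneousSubmodule σ K d).map (Ideal.Quotient.mkₐ K J).toLinearMap

/-- The Hilbert function of `P / J` in nonnegative degrees, where `P` is the polynomial ring. -/
def quotHF (J : Ideal (MvPolynomial σ K)) (d : ℕ) : ℕ :=
  finrank K (quotComponent J d)

theorem mem_idealComponent {J : Ideal (MvPolynomial σ K)} {d : ℕ} {f : MvPolynomial σ K} :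
    f ∈ idealComponent J d ↔ f.IsHomogeneous d ∧ f ∈ J :=
  Iff.rfl

theorem mk_mem_quotComponent (J : Ideal (MvPolynomial σ K)) {d : ℕ} {f : MvPolynomial σ K}
    (hf : f.IsHomogeneous d) : Ideal.Quotient.mk J f ∈ quotComponent J d :=
  ⟨f, hf, rfl⟩

theorem mem_quotComponent {J : Ideal (MvPolynomial σ K)} {d : ℕ} {x : MvPolynomial σ K ⧸ J} :
    x ∈ quotComponent J d ↔ ∃ f, f.IsHomogeneous d ∧ Ideal.Quotient.mk J f = x :=
  Iff.rfl

theorem ker_mkₐ_toLinearMap (J : Ideal (MvPolynomial σ K)) :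
    (Ideal.Quotient.mkₐ K J).toLinearMap.ker = J.restrictScalars K := by
  ext f
  exact Ideal.Quotient.eq_zero_iff_mem

theorem quotHF_zero {J : Ideal (MvPolynomial σ K)} (hJ : J ≠ ⊤) : quotHF J 0 = 1 := by
  have : Nontrivial (MvPolynomial σ K ⧸ J) := Ideal.Quotient.nontrivial_iff.2 hJ
  have h : quotComponent J 0 = Submodule.span K {1} := by
    rw [quotComponent, homogeneousSubmodule_zero, Submodule.one_eq_span, Submodule.map_span,
      Set.image_singleton, AlgHom.toLinearMap_apply, map_one]
  rw [quotHF, h, finrank_span_singleton one_ne_zero]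

variable [Finite σ]

instance finite_homogeneousSubmodule (d : ℕ) : Module.Finite K (homogeneousSubmodule σ K d) :=
  Module.Finite.iff_fg.2 (homogeneousSubmodule_fg _ _ d)

instance finite_idealComponent (J : Ideal (MvPolynomial σ K)) (d : ℕ) :
    Module.Finite K (idealComponent J d) :=
  Submodule.finiteDimensional_of_le inf_le_left

instance finite_quotComponent (J : Ideal (MvPolynomial σ K)) (d : ℕ) :
    Module.Finite K (quotComponent J d) :=
  Module.Finite.map _ _

theorem quotHF_add_finrank_idealComponent (J : Ideal (MvPolynomial σ K)) (d : ℕ) :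
    quotHF J d + finrank K (idealComponent J d) = finrank K (homogeneousSubmodule σ K d) := by
  rw [← finrank_map_add_finrank_inf_ker (Ideal.Quotient.mkₐ K J).toLinearMap
    (homogeneousSubmodule σ K d), ker_mkₐ_toLinearMap]
  rfl

end GradedPieces

namespace ZeroDimScheme

variable {K : Type*} [Field K] {n : ℕ} (𝕏 : ZeroDimScheme K n)

theorem isHomogeneous_ideal :
    𝕏.ideal.IsHomogeneous (homogeneousSubmodule (Fin (n + 1)) K) := fun d f hf => by
  have := 𝕏.homogeneous f hf d
  rwa [← decomposition.decompose'_apply] at this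

theorem ideal_ne_top : 𝕏.ideal ≠ ⊤ := fun h => by
  have : Subsingleton 𝕏.coordRing := Ideal.Quotient.subsingleton_iff.2 h
  simpa [ringKrullDim_eq_bot_of_subsingleton] using 𝕏.dim_eq_one

theorem coordComponent_of_neg {i : ℤ} (hi : i < 0) : 𝕏.coordComponent i = ⊥ := by
  obtain ⟨d, rfl⟩ := Int.eq_negSucc_of_lt_zero hi
  rfl

theorem HF_natCast (d : ℕ) : 𝕏.HF d = quotHF 𝕏.ideal d :=
  rfl

theorem HF_of_neg {i : ℤ} (hi : i < 0) : 𝕏.HF i = 0 := by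
  rw [HF, hilbertFun, 𝕏.coordComponent_of_neg hi, finrank_bot, Nat.cast_zero]

theorem HF_zero : 𝕏.HF 0 = 1 := by
  rw [← Nat.cast_zero, HF_natCast, quotHF_zero 𝕏.ideal_ne_top, Nat.cast_one]

end ZeroDimScheme

section Differentials

open KaehlerDifferential TensorProduct

theorem exists_sub_D_mem_smul_top {K A : Type*} [CommRing K] [CommRing A] [Algebra K A]
    (I : Ideal A) {ω : Ω[A⁄K]} (hω : map K K A (A ⧸ I) ω = 0) :
    ∃ f ∈ I, ω - D K A f ∈ I • (⊤ : Submodule A Ω[A⁄K]) := by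
  obtain ⟨y, hy⟩ := (exact_kerCotangentToTensor_mapBaseChange K A (A ⧸ I)
    Ideal.Quotient.mk_surjective (1 ⊗ₜ ω)).1 (by rw [mapBaseChange_tmul, hω, smul_zero])
  obtain ⟨⟨f, hf⟩, rfl⟩ := Ideal.toCotangent_surjective _ y
  refine ⟨f, Ideal.Quotient.eq_zero_iff_mem.1 hf, ?_⟩
  rw [kerCotangentToTensor_toCotangent, eq_comm] at hy
  have := congrArg (quotTensorEquivQuotSMul Ω[A⁄K] I) hy
  rwa [← map_one (Ideal.Quotient.mk I), quotTensorEquivQuotSMul_mk_tmul,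
    quotTensorEquivQuotSMul_mk_tmul, one_smul, one_smul, Submodule.Quotient.eq] at this

section Gradient

variable {K σ : Type*} [Field K] (J : Ideal (MvPolynomial σ K))

/-- The gradient `f ↦ (∂f/∂x_k mod J)_k`. -/
def gradientMod : MvPolynomial σ K →ₗ[K] (σ → MvPolynomial σ K ⧸ J) :=
  LinearMap.pi fun k => (Ideal.Quotient.mkₐ K J).toLinearMap ∘ₗ (pderiv k).toLinearMap

theorem gradientMod_apply (f : MvPolynomial σ K) (k : σ) :
    gradientMod J f k = Ideal.Quotient.mk J (pderiv k f) :=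
  rfl

variable [Fintype σ]

/-- The map `(h_k)_k ↦ ∑ h_k dx_k` onto the differentials of `P / J`, where `P` is the polynomial
ring. -/
def sumSmulD : (σ → MvPolynomial σ K ⧸ J) →ₗ[K] Ω[MvPolynomial σ K ⧸ J⁄K] :=
  (Fintype.linearCombination (MvPolynomial σ K ⧸ J)
    fun k => D K _ (Ideal.Quotient.mk J (X k))).restrictScalars K

theorem sumSmulD_apply (h : σ → MvPolynomial σ K ⧸ J) :
    sumSmulD J h = ∑ k, h k • D K _ (Ideal.Quotient.mk J (X k)) :=
  rfl

theorem sumSmulD_smul (a : MvPolynomial σ K ⧸ J) (h : σ → MvPolynomial σ K ⧸ J) :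
    sumSmulD J (a • h) = a • sumSmulD J h :=
  map_smul (Fintype.linearCombination _ _) a h

theorem sumSmulD_mk (h : σ → MvPolynomial σ K) :
    sumSmulD J (fun k => Ideal.Quotient.mk J (h k)) =
      map K K _ (MvPolynomial σ K ⧸ J) (∑ k, h k • D K (MvPolynomial σ K) (X k)) := by
  simp only [sumSmulD_apply, map_sum, map_smul, map_D]
  rfl

theorem D_eq_sum_pderiv_smul (f : MvPolynomial σ K) :
    D K (MvPolynomial σ K) f = ∑ k, pderiv k f • D K (MvPolynomial σ K) (X k) := by
  simpa using ((mvPolynomialBasis K σ).sum_repr (D K (MvPolynomial σ K) f)).symm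

theorem sumSmulD_gradientMod (f : MvPolynomial σ K) :
    sumSmulD J (gradientMod J f) = D K _ (Ideal.Quotient.mk J f) := by
  rw [funext (gradientMod_apply J f), sumSmulD_mk, ← D_eq_sum_pderiv_smul, map_D]
  rfl

theorem ker_sumSmulD : (sumSmulD J).ker = (J.restrictScalars K).map (gradientMod J) := by
  classical
  refine le_antisymm (fun h hh => ?_) ?_
  · choose H hH using fun k => Ideal.Quotient.mk_surjective (h k)
    obtain rfl : (fun k => Ideal.Quotient.mk J (H k)) = h := funext hH
    rw [LinearMap.mem_ker, sumSmulD_mk] at hh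
    obtain ⟨f, hf, hfH⟩ := exists_sub_D_mem_smul_top J hh
    refine ⟨f, hf, funext fun k => ?_⟩
    have := Submodule.smul_top_le_comap_smul_top J (pderiv k).liftKaehlerDifferential hfH
    rw [gradientMod_apply, eq_comm, Ideal.Quotient.mk_eq_mk_iff_sub_mem]
    simpa [pderiv_X, Pi.single_apply] using this
  · rintro _ ⟨f, hf, rfl⟩
    rw [LinearMap.mem_ker, sumSmulD_gradientMod, Ideal.Quotient.eq_zero_iff_mem.2 hf, map_zero]

end Gradient

section Pi

variable {K V ι : Type*} [DivisionRing K] [AddCommGroup V] [Module K V] (p : Submodule K V)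

theorem pi_univ_const_eq_range :
    (Submodule.pi (Set.univ : Set ι) fun _ => p) = (p.subtype.compLeft ι).range := by
  rw [LinearMap.range_compLeft, p.range_subtype]

variable [FiniteDimensional K p]

instance finite_pi_univ_const [Finite ι] :
    FiniteDimensional K (Submodule.pi (Set.univ : Set ι) fun _ => p) := by
  rw [pi_univ_const_eq_range]
  infer_instance

theorem finrank_pi_univ_const [Fintype ι] :
    finrank K (Submodule.pi (Set.univ : Set ι) fun _ => p) = Fintype.card ι * finrank K p := by
  rw [pi_univ_const_eq_range, LinearMap.finrank_range_of_inj p.injective_subtype.comp_left,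
    finrank_pi_fintype, Finset.sum_const, Finset.card_univ, smul_eq_mul]

end Pi

section Components

variable {K : Type*} [Field K] {n : ℕ} {J : Ideal (MvPolynomial (Fin (n + 1)) K)}

theorem pi_quotComponent_inf_ker_sumSmulD
    (hJ : J.IsHomogeneous (homogeneousSubmodule (Fin (n + 1)) K)) (d : ℕ) :
    (Submodule.pi Set.univ fun _ => quotComponent J d) ⊓ (sumSmulD J).ker =
      (idealComponent J (d + 1)).map (gradientMod J) := by
  rw [ker_sumSmulD]
  refine le_antisymm ?_ (le_inf ?_ (Submodule.map_mono inf_le_right))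
  · rintro _ ⟨hd, f, hf, rfl⟩
    refine ⟨homogeneousComponent (d + 1) f,
      ⟨homogeneousComponent_isHomogeneous _ _, homogeneousComponent_mem_of_mem hJ hf _⟩,
      funext fun k => ?_⟩
    obtain ⟨g, hg, hgf⟩ := mem_quotComponent.1 (hd k trivial)
    rw [gradientMod_apply, Ideal.Quotient.mk_eq_mk_iff_sub_mem] at hgf
    have := homogeneousComponent_mem_of_mem hJ hgf d
    rw [map_sub, homogeneousComponent_pderiv, homogeneousComponent_eq_self hg,
      ← Ideal.Quotient.mk_eq_mk_iff_sub_mem] at this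
    rw [gradientMod_apply, ← this, gradientMod_apply, Ideal.Quotient.mk_eq_mk_iff_sub_mem]
    exact hgf
  · rintro _ ⟨f, hf, rfl⟩ k -
    exact mk_mem_quotComponent J hf.1.pderiv

theorem idealComponent_inf_ker_gradientMod (d : ℕ) :
    idealComponent J d ⊓ (gradientMod J).ker = idealComponent (diffPower K J 2) d := by
  ext f
  have : f ∈ (gradientMod J).ker ↔ ∀ k, pderiv k f ∈ J := by
    simp only [LinearMap.mem_ker, funext_iff, gradientMod_apply, Pi.zero_apply,
      Ideal.Quotient.eq_zero_iff_mem]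
  simp only [Submodule.mem_inf, mem_idealComponent, mem_diffPower_two_iff, this, and_assoc]

theorem finrank_map_sumSmulD_add (hJ : J.IsHomogeneous (homogeneousSubmodule (Fin (n + 1)) K))
    (d : ℕ) :
    finrank K ((Submodule.pi Set.univ fun _ => quotComponent J d).map (sumSmulD J)) +
      quotHF (diffPower K J 2) (d + 1) = (n + 1) * quotHF J d + quotHF J (d + 1) := by
  have hL := finrank_map_add_finrank_inf_ker (sumSmulD J)
    (Submodule.pi Set.univ fun _ => quotComponent J d)
  have hG := finrank_map_add_finrank_inf_ker (gradientMod J) (idealComponent J (d + 1))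
  rw [pi_quotComponent_inf_ker_sumSmulD hJ, finrank_pi_univ_const, Fintype.card_fin] at hL
  rw [idealComponent_inf_ker_gradientMod] at hG
  have hX := quotHF_add_finrank_idealComponent J (d + 1)
  have hY := quotHF_add_finrank_idealComponent (diffPower K J 2) (d + 1)
  unfold quotHF at *
  linarith

end Components

end Differentials

namespace ZeroDimScheme

open KaehlerDifferential

variable {K : Type*} [Field K] {n : ℕ} (𝕏 : ZeroDimScheme K n)

theorem kaehlerComponent_le {i : ℤ} {S : Submodule K Ω[𝕏.coordRing⁄K]}
    (hS : ∀ a b : ℕ, (a + b + 1 : ℤ) = i → ∀ f g, f.IsHomogeneous a → g.IsHomogeneous (b + 1) →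
      Ideal.Quotient.mk 𝕏.ideal f • D K 𝕏.coordRing (Ideal.Quotient.mk 𝕏.ideal g) ∈ S) :
    𝕏.kaehlerComponent i ≤ S := by
  rw [kaehlerComponent, Submodule.span_le]
  rintro _ ⟨a | a, b | b, rfl, f, hf, g, hg, rfl⟩
  · obtain ⟨F, hF, rfl⟩ := hf
    obtain ⟨G, hG, rfl⟩ := hg
    cases b with
    | zero =>
      rw [homogeneousSubmodule_zero] at hG
      obtain ⟨c, rfl⟩ := Submodule.mem_one.1 hG
      simp
    | succ b => exact hS a b (by simp [add_assoc]) F G hF hG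
  · simp [(Submodule.mem_bot K).1 hg]
  all_goals
    rw [(Submodule.mem_bot K).1 hf]
    exact (zero_smul 𝕏.coordRing (D K 𝕏.coordRing g)).symm ▸ S.zero_mem

theorem kaehlerComponent_of_nonpos {i : ℤ} (hi : i ≤ 0) : 𝕏.kaehlerComponent i = ⊥ :=
  le_bot_iff.1 <| 𝕏.kaehlerComponent_le fun a b hab => by omega

theorem kaehlerComponent_succ (d : ℕ) : 𝕏.kaehlerComponent (d + 1) =
    (Submodule.pi Set.univ fun _ => quotComponent 𝕏.ideal d).map (sumSmulD 𝕏.ideal) := by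
  refine le_antisymm (𝕏.kaehlerComponent_le fun a b hab f g hf hg => ?_) ?_
  · obtain rfl : a + b = d := by omega
    refine ⟨Ideal.Quotient.mk 𝕏.ideal f • gradientMod 𝕏.ideal g, fun k _ => ?_, ?_⟩
    · exact mk_mem_quotComponent 𝕏.ideal (hf.mul hg.pderiv)
    · rw [sumSmulD_smul, sumSmulD_gradientMod]
  · rintro _ ⟨h, hh, rfl⟩
    rw [sumSmulD_apply]
    refine Submodule.sum_mem _ fun k _ => Submodule.subset_span ?_
    have hX := mk_mem_quotComponent 𝕏.ideal (isHomogeneous_X K k)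
    exact ⟨d, 1, rfl, h k, hh k trivial, _, hX, rfl⟩

theorem HFOmega_of_nonpos {i : ℤ} (hi : i ≤ 0) : 𝕏.HFOmega i = 0 := by
  rw [HFOmega, hilbertFun, 𝕏.kaehlerComponent_of_nonpos hi, finrank_bot, Nat.cast_zero]

theorem HFOmega_natCast (i : ℕ) :
    𝕏.HFOmega i = (n + 1) * 𝕏.HF (i - 1) + 𝕏.HF i - 𝕏.diffFattening.HF i := by
  cases i with
  | zero => simp [HFOmega_of_nonpos, HF_of_neg, HF_zero]
  | succ d =>
    have h := finrank_map_sumSmulD_add 𝕏.isHomogeneous_ideal d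
    rw [← kaehlerComponent_succ] at h
    rw [HFOmega, hilbertFun, HF_natCast, HF_natCast, Nat.cast_succ, add_sub_cancel_right,
      HF_natCast, eq_sub_iff_add_eq]
    exact_mod_cast h

end ZeroDimScheme

open Polynomial TensorProduct in
theorem injective_mulLeft_sum_X_pow_tmul {K A : Type*} [Field K] [CommRing A] [Algebra K A]
    {m : ℕ} {x : Fin m → A} (hx : ∀ a, (∀ i, a * x i = 0) → a = 0) :
    Function.Injective (LinearMap.mulLeft K[X]
      (∑ i : Fin m, (Polynomial.X ^ (i : ℕ) : K[X]) ⊗ₜ[K] x i)) := by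
  let e : K[X] ⊗[K] A ≃ₐ[K] A[X] :=
    (Algebra.TensorProduct.comm K K[X] A).trans (polyEquivTensor K A).symm
  have he : e (∑ i : Fin m, (Polynomial.X ^ (i : ℕ) : K[X]) ⊗ₜ[K] x i) ∈ nonZeroDivisors A[X] := by
    refine Polynomial.mem_nonZeroDivisors_iff.2 fun a ha => hx a fun i => ?_
    have := congrArg (Polynomial.coeff · (i : ℕ)) ha
    simpa [e, finsetSum_coeff, Polynomial.coeff_X_pow, Fin.val_inj] using this
  refine (injective_iff_map_eq_zero _).2 fun z hz => ?_
  rw [LinearMap.mulLeft_apply, ← map_eq_zero_iff e e.injective, map_mul] at hz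
  exact (map_eq_zero_iff e e.injective).1 ((mem_nonZeroDivisors_iff.1 he).1 _ hz)

open TensorProduct in
theorem finrank_le_of_injective_tensorProduct {K S V W : Type*} [Field K] [CommRing S]
    [Nontrivial S] [Algebra K S] [AddCommGroup V] [Module K V] [AddCommGroup W] [Module K W]
    [FiniteDimensional K W] {μ : S ⊗[K] V →ₗ[S] S ⊗[K] W} (hμ : Function.Injective μ) :
    finrank K V ≤ finrank K W := by
  simpa only [finrank_baseChange] using LinearMap.finrank_le_finrank_of_injective hμ

open Polynomial TensorProduct in
theorem finrank_le_finrank_of_mul_mem {K A : Type*} [Field K] [CommRing A] [Algebra K A]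
    {m : ℕ} {x : Fin m → A} (hx : ∀ a, (∀ i, a * x i = 0) → a = 0) {V W : Submodule K A}
    [FiniteDimensional K W] (hVW : ∀ i, ∀ v ∈ V, x i * v ∈ W) :
    finrank K V ≤ finrank K W := by
  let ι (U : Submodule K A) : K[X] ⊗[K] U →ₗ[K[X]] K[X] ⊗[K] A := U.subtype.baseChange K[X]
  have hι (U : Submodule K A) : Function.Injective (ι U) :=
    Flat.lTensor_preserves_injective_linearMap _ U.injective_subtype
  let μ : K[X] ⊗[K] V →ₗ[K[X]] K[X] ⊗[K] W := ∑ i : Fin m,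
    (Polynomial.X : K[X]) ^ (i : ℕ) • ((LinearMap.mulLeft K (x i)).restrict (hVW i)).baseChange K[X]
  have hμ : ι W ∘ₗ μ =
      LinearMap.mulLeft K[X] (∑ i : Fin m, (Polynomial.X ^ (i : ℕ) : K[X]) ⊗ₜ[K] x i) ∘ₗ ι V := by
    ext v
    simp [ι, μ, Finset.sum_mul, TensorProduct.smul_tmul']
    rfl
  have hinj : Function.Injective μ := by
    refine .of_comp (f := ι W) ?_
    rw [← LinearMap.coe_comp, hμ, LinearMap.coe_comp]
    exact (injective_mulLeft_sum_X_pow_tmul hx).comp (hι V)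
  exact finrank_le_of_injective_tensorProduct hinj

theorem le_of_sum_range_le {h : ℕ → ℕ} (hm : Monotone h) {a b : ℕ}
    (hs : ∀ d, ∑ i ∈ Finset.range d, h i ≤ a + b * d) (d : ℕ) : h d ≤ a + 2 * b := by
  have hsum : (d + 1) * h d ≤ ∑ i ∈ Finset.range (d + (d + 1)), h i := by
    rw [Finset.sum_range_add]
    refine le_add_left ?_
    simpa using Finset.card_nsmul_le_sum (Finset.range (d + 1)) (fun i => h (d + i)) (h d)
      fun i _ => hm (Nat.le_add_right d i)
  have := hsum.trans (hs _)
  refine Nat.le_of_mul_le_mul_left (this.trans ?_) d.succ_pos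
  nlinarith

theorem eventually_eq_iSup {h : ℕ → ℕ} (hm : Monotone h) (hb : BddAbove (Set.range h)) :
    ∀ᶠ d in atTop, h d = ⨆ i, h i := by
  simpa only [nhds_discrete, tendsto_pure] using tendsto_atTop_ciSup hm hb

section LinearGrowth

theorem ringKrullDim_le_of_isIntegral {B C : Type*} [CommRing B] [CommRing C] [Algebra B C]
    [Algebra.IsIntegral B C] (hinj : Function.Injective (algebraMap B C)) :
    ringKrullDim B ≤ ringKrullDim C := by
  refine iSup_le fun l => ?_
  obtain ⟨Q, -, hQ, hQl⟩ := Ideal.exists_ideal_over_prime_of_isIntegral (S := C)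
    l.head.asIdeal ⊥ (((RingHom.injective_iff_ker_eq_bot _).1 hinj).trans_le bot_le)
  have : Q.LiesOver l.head.asIdeal := ⟨hQl.symm⟩
  obtain ⟨L, hL, -⟩ := Ideal.exists_ltSeries_of_hasGoingUp l Q
  exact hL ▸ le_iSup (fun p : LTSeries (PrimeSpectrum C) => (p.length : WithBot ℕ∞)) L

variable {K A : Type*} [Field K] [CommRing A] [Algebra K A]

theorem exists_aeval_finite [Nontrivial A] [Algebra.FiniteType K A] (hA : ringKrullDim A ≤ 1) :
    ∃ y : A, (Polynomial.aeval y : Polynomial K →ₐ[K] A).Finite := by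
  obtain ⟨s, φ, hinj, hfin⟩ := exists_finite_inj_algHom_of_fg K A
  have hs : s ≤ 1 := by
    algebraize [φ.toRingHom]
    have : Algebra.IsIntegral (MvPolynomial (Fin s) K) A := ⟨hfin.to_isIntegral⟩
    have hle := (ringKrullDim_le_of_isIntegral (B := MvPolynomial (Fin s) K) hinj).trans hA
    rw [ringKrullDim_of_isNoetherianRing, ringKrullDim_eq_zero_of_field, Nat.card_fin,
      zero_add] at hle
    exact_mod_cast hle
  obtain ⟨y, hy⟩ : ∃ y, ∀ i, φ (X i) = y := by
    rcases Nat.le_one_iff_eq_zero_or_eq_one.1 hs with rfl | rfl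
    · exact ⟨0, fun i => i.elim0⟩
    · exact ⟨φ (X 0), fun i => by rw [Subsingleton.elim i 0]⟩
  have hφ : φ = (Polynomial.aeval y).comp (aeval fun _ => Polynomial.X) := by
    ext i
    simp [hy]
  exact ⟨y, .of_comp_finite (hφ ▸ hfin)⟩

theorem finrank_mul_le (M N : Submodule K A) [FiniteDimensional K M] [FiniteDimensional K N] :
    finrank K ↥(M * N) ≤ finrank K M * finrank K N := by
  rw [← Submodule.mulMap_range, ← finrank_tensorProduct]
  exact LinearMap.finrank_range_le _

/-- The space of all `p(y)`, where `p` is a polynomial of degree less than `m`. -/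
def aevalDegreeLT (y : A) (m : ℕ) : Submodule K A :=
  (Polynomial.degreeLT K m).map (Polynomial.aeval y).toLinearMap

instance finite_degreeLT (m : ℕ) : FiniteDimensional K (Polynomial.degreeLT K m) :=
  Module.Finite.equiv (Polynomial.degreeLTEquiv K m).symm

instance finite_aevalDegreeLT (y : A) (m : ℕ) : FiniteDimensional K (aevalDegreeLT (K := K) y m) :=
  Module.Finite.map _ _

theorem finrank_aevalDegreeLT_le (y : A) (m : ℕ) :
    finrank K (aevalDegreeLT (K := K) y m) ≤ m :=
  (Submodule.finrank_map_le _ _).trans_eq <| by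
    rw [(Polynomial.degreeLTEquiv K m).finrank_eq, finrank_fin_fun]

theorem monotone_aevalDegreeLT_mul (y : A) (G : Submodule K A) :
    Monotone fun m => aevalDegreeLT y m * G := fun _ _ h =>
  mul_le_mul' (Submodule.map_mono (Polynomial.degreeLT_mono h)) le_rfl

theorem aevalDegreeLT_mul_le (y : A) (a b : ℕ) :
    aevalDegreeLT (K := K) y a * aevalDegreeLT y b ≤ aevalDegreeLT y (a + b) := by
  rw [aevalDegreeLT, aevalDegreeLT, ← Submodule.map_mul]
  refine Submodule.map_mono (Submodule.mul_le.2 fun p hp q hq => ?_)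
  rcases eq_or_ne p 0 with rfl | hp0
  · simp
  rw [Polynomial.mem_degreeLT] at *
  rw [Polynomial.degree_mul, Nat.cast_add]
  exact WithBot.add_lt_add_of_le_of_lt (Polynomial.degree_ne_bot.2 hp0) hp.le hq

theorem aeval_mem_aevalDegreeLT (y : A) (p : Polynomial K) :
    Polynomial.aeval y p ∈ aevalDegreeLT (K := K) y (p.natDegree + 1) := by
  refine Submodule.mem_map_of_mem (Polynomial.mem_degreeLT.2 ?_)
  exact Polynomial.degree_le_natDegree.trans_lt (by exact_mod_cast p.natDegree.lt_succ_self)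

theorem exists_fg_forall_mem_aevalDegreeLT_mul {y : A}
    (hy : (Polynomial.aeval y : Polynomial K →ₐ[K] A).Finite) :
    ∃ G : Submodule K A, G.FG ∧ ∀ r, ∃ c, r ∈ aevalDegreeLT y c * G := by
  algebraize [(Polynomial.aeval y : Polynomial K →ₐ[K] A).toRingHom]
  obtain ⟨s, hs⟩ := (show Module.Finite (Polynomial K) A from hy).fg_top
  refine ⟨Submodule.span K s, ⟨s, rfl⟩, fun r => ?_⟩
  have hr : r ∈ Submodule.span (Polynomial K) (s : Set A) := hs ▸ trivial
  induction hr using Submodule.span_induction with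
  | mem g hg =>
    refine ⟨1, one_mul g ▸ Submodule.mul_mem_mul ?_ (Submodule.subset_span hg)⟩
    simpa using aeval_mem_aevalDegreeLT (K := K) y 1
  | zero => exact ⟨0, zero_mem _⟩
  | add a b _ _ ha hb =>
    obtain ⟨c, hc⟩ := ha
    obtain ⟨d, hd⟩ := hb
    exact ⟨max c d, add_mem
      (monotone_aevalDegreeLT_mul y _ (le_max_left c d) hc)
      (monotone_aevalDegreeLT_mul y _ (le_max_right c d) hd)⟩
  | smul p a _ ha =>
    obtain ⟨c, hc⟩ := ha
    refine ⟨p.natDegree + 1 + c, mul_le_mul' (aevalDegreeLT_mul_le y _ c) le_rfl ?_⟩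
    rw [mul_assoc]
    exact Submodule.mul_mem_mul (aeval_mem_aevalDegreeLT y p) hc

theorem exists_finrank_pow_le [Nontrivial A] [Algebra.FiniteType K A] (hA : ringKrullDim A ≤ 1)
    {V : Submodule K A} (hV : V.FG) : ∃ a b, ∀ d, finrank K ↥(V ^ d) ≤ a + b * d := by
  obtain ⟨y, hy⟩ := exists_aeval_finite (K := K) hA
  obtain ⟨G, hG, hmem⟩ := exists_fg_forall_mem_aevalDegreeLT_mul hy
  have hle {W : Submodule K A} (hW : W.FG) : ∃ c, W ≤ aevalDegreeLT y c * G := by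
    obtain ⟨s, rfl⟩ := hW
    choose c hc using hmem
    exact ⟨s.sup c, Submodule.span_le.2 fun r hr =>
      monotone_aevalDegreeLT_mul y G (Finset.le_sup hr) (hc r)⟩
  obtain ⟨a, ha⟩ := hmem 1
  obtain ⟨b, hb⟩ := hle (hV.mul hG)
  have hpow (d : ℕ) : V ^ d ≤ aevalDegreeLT y (a + b * d) * G := by
    induction d with
    | zero => exact Submodule.one_le.2 ha
    | succ d ih => calc
        V ^ (d + 1) ≤ aevalDegreeLT y (a + b * d) * G * V := mul_le_mul' ih le_rfl
        _ = aevalDegreeLT y (a + b * d) * (V * G) := by rw [mul_assoc, mul_comm G]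
        _ ≤ aevalDegreeLT y (a + b * d) * (aevalDegreeLT y b * G) :=
          mul_le_mul' le_rfl hb
        _ ≤ aevalDegreeLT y (a + b * (d + 1)) * G := by
          rw [← mul_assoc, mul_add_one, ← add_assoc]
          exact mul_le_mul' (aevalDegreeLT_mul_le y _ b) le_rfl
  have : FiniteDimensional K G := Module.Finite.iff_fg.2 hG
  refine ⟨a * finrank K G, b * finrank K G, fun d => ?_⟩
  have : FiniteDimensional K (aevalDegreeLT y (a + b * d) * G : Submodule K A) :=
    Module.Finite.iff_fg.2 ((Module.Finite.iff_fg.1 inferInstance).mul hG)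
  calc finrank K ↥(V ^ d)
    _ ≤ finrank K (aevalDegreeLT y (a + b * d) * G : Submodule K A) :=
      Submodule.finrank_mono (hpow d)
    _ ≤ (a + b * d) * finrank K G :=
      (finrank_mul_le _ _).trans (Nat.mul_le_mul_right _ (finrank_aevalDegreeLT_le y _))
    _ = a * finrank K G + b * finrank K G * d := by ring

end LinearGrowth

theorem quotComponent_one_pow {K σ : Type*} [Field K] (J : Ideal (MvPolynomial σ K)) (d : ℕ) :
    quotComponent J 1 ^ d = quotComponent J d := by
  rw [quotComponent, ← Submodule.map_pow, homogeneousSubmodule_one_pow, quotComponent]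

section SumQuotHF

variable {K σ : Type*} [Field K] [Finite σ] {J : Ideal (MvPolynomial σ K)}

theorem sum_quotHF_le_finrank (hJ : J.IsHomogeneous (homogeneousSubmodule σ K)) {d : ℕ}
    {W : Submodule K (MvPolynomial σ K ⧸ J)} [FiniteDimensional K W]
    (hW : ∀ i < d, quotComponent J i ≤ W) : ∑ i ∈ Finset.range d, quotHF J i ≤ finrank K W := by
  let T : (∀ i : Fin d, quotComponent J i) →ₗ[K] MvPolynomial σ K ⧸ J :=
    LinearMap.lsum K _ K fun i => (quotComponent J i).subtype
  have hTW : T.range ≤ W := by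
    rintro _ ⟨v, rfl⟩
    simpa [T] using W.sum_mem fun (i : Fin d) _ => hW i i.2 (v i).2
  have hT : Function.Injective T := by
    refine (injective_iff_map_eq_zero T).2 fun v hv => funext fun j => Subtype.ext ?_
    choose F hF hFv using fun i => mem_quotComponent.1 (v i).2
    have hsum : ∑ i, F i ∈ J := by
      rw [← Ideal.Quotient.eq_zero_iff_mem, ← hv, map_sum]
      simp [T, hFv]
    have := homogeneousComponent_mem_of_mem hJ hsum j
    simpa [homogeneousComponent_of_mem (hF _), Fin.val_inj, ← hFv,
      Ideal.Quotient.eq_zero_iff_mem] using this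
  have := (LinearMap.finrank_range_of_inj hT).symm.trans_le (Submodule.finrank_mono hTW)
  rw [finrank_pi_fintype] at this
  exact (Fin.sum_univ_eq_sum_range (quotHF J) d).symm.trans_le this

theorem exists_sum_quotHF_le (hJ : J.IsHomogeneous (homogeneousSubmodule σ K)) (hJ' : J ≠ ⊤)
    (hdim : ringKrullDim (MvPolynomial σ K ⧸ J) ≤ 1) :
    ∃ a b, ∀ d, ∑ i ∈ Finset.range d, quotHF J i ≤ a + b * d := by
  have : Nontrivial (MvPolynomial σ K ⧸ J) := Ideal.Quotient.nontrivial_iff.2 hJ'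
  obtain ⟨V, hV, hV₁, hVJ⟩ : ∃ V, V.FG ∧ 1 ≤ V ∧ quotComponent J 1 ≤ V := by
    refine ⟨1 ⊔ quotComponent J 1, ?_, le_sup_left, le_sup_right⟩
    rw [Submodule.one_eq_span]
    exact (Submodule.fg_span_singleton 1).sup (Module.Finite.iff_fg.1 (finite_quotComponent J 1))
  obtain ⟨a, b, hab⟩ := exists_finrank_pow_le hdim hV
  refine ⟨a, b, fun d => le_trans ?_ (hab d)⟩
  have : FiniteDimensional K ↥(V ^ d) := Module.Finite.iff_fg.2 (hV.pow d)
  refine sum_quotHF_le_finrank hJ fun i hi => ?_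
  rw [← quotComponent_one_pow]
  exact (pow_le_pow_left' hVJ i).trans (pow_le_pow_right' hV₁ hi.le)

end SumQuotHF

namespace ZeroDimScheme

variable {K : Type*} [Field K] {n : ℕ} (𝕏 : ZeroDimScheme K n)

theorem monotone_quotHF : Monotone (quotHF 𝕏.ideal) := by
  refine monotone_nat_of_le_succ fun d =>
    finrank_le_finrank_of_mul_mem (x := fun k => Ideal.Quotient.mk 𝕏.ideal (X k)) ?_ ?_
  · intro a ha
    obtain ⟨f, rfl⟩ := Ideal.Quotient.mk_surjective a
    refine Ideal.Quotient.eq_zero_iff_mem.2 (𝕏.saturated f fun k => ?_)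
    rw [← Ideal.Quotient.eq_zero_iff_mem, mul_comm, map_mul]
    exact ha k
  · rintro k _ ⟨f, hf, rfl⟩
    simpa [add_comm 1 d] using mk_mem_quotComponent 𝕏.ideal ((isHomogeneous_X K k).mul hf)

theorem eventually_quotHF_eq_iSup : ∀ᶠ d in atTop, quotHF 𝕏.ideal d = ⨆ d, quotHF 𝕏.ideal d := by
  obtain ⟨a, b, hab⟩ :=
    exists_sum_quotHF_le 𝕏.isHomogeneous_ideal 𝕏.ideal_ne_top 𝕏.dim_eq_one.le
  refine eventually_eq_iSup 𝕏.monotone_quotHF ⟨a + 2 * b, ?_⟩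
  rintro _ ⟨d, rfl⟩
  exact le_of_sum_range_le 𝕏.monotone_quotHF hab d

end ZeroDimScheme

namespace IsHilbertPoly

theorem hilbertPoly_eq {F : ℤ → ℤ} {q : Polynomial ℚ} (h : IsHilbertPoly F q) :
    hilbertPoly F = q := by
  have hex : ∃ q, IsHilbertPoly F q := ⟨q, h⟩
  rw [hilbertPoly, dif_pos hex]
  obtain ⟨N, hN⟩ := h
  obtain ⟨M, hM⟩ := hex.choose_spec
  refine Polynomial.eq_of_infinite_eval_eq _ _ <|
    ((Set.Ici_infinite (max N M)).image Int.cast_injective.injOn).mono ?_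
  rintro _ ⟨i, hi, rfl⟩
  exact (hM i (le_of_max_le_right hi)).symm.trans (hN i (le_of_max_le_left hi))

theorem isLeast_regularityIndex {F : ℤ → ℤ} {q : Polynomial ℚ} (h : IsHilbertPoly F q)
    (hF : BddBelow (regularitySet F)) : IsLeast (regularitySet F) (regularityIndex F) := by
  have hne : (regularitySet F).Nonempty := by
    obtain ⟨N, hN⟩ := h
    exact ⟨N, fun j hj => by rw [hN j hj, hilbertPoly_eq ⟨N, hN⟩]⟩
  exact ⟨Int.csInf_mem hne hF, fun i hi => csInf_le hF hi⟩

end IsHilbertPoly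

namespace ZeroDimScheme

variable {K : Type*} [Field K] {n : ℕ} (𝕏 : ZeroDimScheme K n)

theorem isHilbertPoly_HF_of_eventually {D : ℕ} (h : ∀ᶠ d in atTop, quotHF 𝕏.ideal d = D) :
    IsHilbertPoly 𝕏.HF (Polynomial.C (D : ℚ)) := by
  obtain ⟨N, hN⟩ := eventually_atTop.1 h
  refine ⟨N, fun i hi => ?_⟩
  lift i to ℕ using (Nat.cast_nonneg N).trans hi
  rw [HF_natCast, hN i (by exact_mod_cast hi), Polynomial.eval_C, Int.cast_natCast]

theorem degree_eq_of_eventually {D : ℕ} (h : ∀ᶠ d in atTop, quotHF 𝕏.ideal d = D) :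
    𝕏.degree = D := by
  rw [degree, (𝕏.isHilbertPoly_HF_of_eventually h).hilbertPoly_eq, Polynomial.coeff_C_zero]

theorem isHilbertPoly_HF : IsHilbertPoly 𝕏.HF (Polynomial.C 𝕏.degree) := by
  rw [𝕏.degree_eq_of_eventually 𝕏.eventually_quotHF_eq_iSup]
  exact 𝕏.isHilbertPoly_HF_of_eventually 𝕏.eventually_quotHF_eq_iSup

theorem degree_pos : 0 < 𝕏.degree := by
  obtain ⟨d, hd⟩ := 𝕏.eventually_quotHF_eq_iSup.exists
  have : 1 ≤ quotHF 𝕏.ideal d :=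
    (quotHF_zero 𝕏.ideal_ne_top).symm.trans_le (𝕏.monotone_quotHF d.zero_le)
  rw [𝕏.degree_eq_of_eventually 𝕏.eventually_quotHF_eq_iSup, ← hd]
  exact_mod_cast this

theorem HF_eq_degree {i j : ℤ} (hi : i ∈ regularitySet 𝕏.HF) (hij : i ≤ j) :
    (𝕏.HF j : ℚ) = 𝕏.degree := by
  rw [hi j hij, 𝕏.isHilbertPoly_HF.hilbertPoly_eq, Polynomial.eval_C]

theorem nonneg_of_mem_regularitySet_HF {i : ℤ} (hi : i ∈ regularitySet 𝕏.HF) : 0 ≤ i := by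
  by_contra! h
  have := 𝕏.HF_eq_degree hi le_rfl
  rw [𝕏.HF_of_neg h, Int.cast_zero] at this
  exact 𝕏.degree_pos.ne this

theorem isLeast_regularityIndex_HF : IsLeast (regularitySet 𝕏.HF) (regularityIndex 𝕏.HF) :=
  𝕏.isHilbertPoly_HF.isLeast_regularityIndex ⟨0, fun _ => 𝕏.nonneg_of_mem_regularitySet_HF⟩

theorem HFOmega_eq_of_le {k : ℤ}
    (hk : max (regularityIndex 𝕏.HF + 1) (regularityIndex 𝕏.diffFattening.HF) ≤ k) :
    (𝕏.HFOmega k : ℚ) = (n + 2) * 𝕏.degree - 𝕏.diffFattening.degree := by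
  obtain ⟨hX, hY⟩ := max_le_iff.1 hk
  have hr := 𝕏.isLeast_regularityIndex_HF.1
  have hr₀ := 𝕏.nonneg_of_mem_regularitySet_HF hr
  lift k to ℕ using by omega
  rw [𝕏.HFOmega_natCast]
  push_cast
  rw [𝕏.HF_eq_degree hr (by omega), 𝕏.HF_eq_degree hr (by omega),
    𝕏.diffFattening.HF_eq_degree 𝕏.diffFattening.isLeast_regularityIndex_HF.1 hY]
  ring

theorem isHilbertPoly_HFOmega :
    IsHilbertPoly 𝕏.HFOmega (Polynomial.C ((n + 2) * 𝕏.degree - 𝕏.diffFattening.degree)) :=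
  ⟨_, fun _ hk => (𝕏.HFOmega_eq_of_le hk).trans Polynomial.eval_C.symm⟩

theorem HFOmega_one_pos : 0 < 𝕏.HFOmega 1 := by
  have h := 𝕏.HFOmega_natCast 1
  have hX : quotHF 𝕏.ideal 0 ≤ quotHF 𝕏.ideal 1 := 𝕏.monotone_quotHF zero_le_one
  have hY : quotHF 𝕏.diffFattening.ideal 1 ≤ n + 1 := by
    refine (Nat.le_add_right _ _).trans
      ((quotHF_add_finrank_idealComponent 𝕏.diffFattening.ideal 1).trans_le ?_)
    rw [homogeneousSubmodule_one_eq_span_X]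
    exact (finrank_range_le_card _).trans_eq (Fintype.card_fin _)
  rw [quotHF_zero 𝕏.ideal_ne_top] at hX
  rw [HF_natCast, HF_natCast, Nat.cast_one, sub_self, HF_zero] at h
  omega

theorem bddBelow_regularitySet_HFOmega : BddBelow (regularitySet 𝕏.HFOmega) := by
  refine ⟨0, fun i hi => ?_⟩
  by_contra! h
  have h₀ := hi i le_rfl
  have h₁ := hi 1 (by omega)
  rw [𝕏.isHilbertPoly_HFOmega.hilbertPoly_eq, Polynomial.eval_C] at h₀ h₁
  rw [← h₀, 𝕏.HFOmega_of_nonpos h.le] at h₁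
  exact 𝕏.HFOmega_one_pos.ne' (by exact_mod_cast h₁)

theorem isLeast_regularityIndex_HFOmega :
    IsLeast (regularitySet 𝕏.HFOmega) (regularityIndex 𝕏.HFOmega) :=
  𝕏.isHilbertPoly_HFOmega.isLeast_regularityIndex 𝕏.bddBelow_regularitySet_HFOmega

theorem regularityIndex_HFOmega_le :
    regularityIndex 𝕏.HFOmega ≤
      max (regularityIndex 𝕏.HF + 1) (regularityIndex 𝕏.diffFattening.HF) := by
  refine 𝕏.isLeast_regularityIndex_HFOmega.2 fun k hk => ?_
  rw [𝕏.isHilbertPoly_HFOmega.hilbertPoly_eq, Polynomial.eval_C, 𝕏.HFOmega_eq_of_le hk]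

end ZeroDimScheme

section ChineseRemainder

theorem prod_sup_le_sup_inf {R ι : Type*} [CommRing R] (J : Ideal R) (Q : ι → Ideal R)
    (s : Finset ι) : ∏ k ∈ s, (J ⊔ Q k) ≤ J ⊔ s.inf Q := by
  classical
  induction s using Finset.induction_on with
  | empty => simp
  | insert k s hk ih =>
    rw [Finset.prod_insert hk, Finset.inf_insert]
    refine (Ideal.mul_mono_right ih).trans ?_
    rw [Ideal.sup_mul, Ideal.mul_sup (Q k)]
    exact sup_le (Ideal.mul_le_left.trans le_sup_left)
      (sup_le (Ideal.mul_le_right.trans le_sup_left) (Ideal.mul_le_inf.trans le_sup_right))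

variable {K σ ι : Type*} [Field K] {Q : ι → Ideal (MvPolynomial σ K)}

theorem mem_idealOfVars_pow_of_isHomogeneous {f : MvPolynomial σ K} {a d : ℕ}
    (hf : f.IsHomogeneous d) (had : a ≤ d) : f ∈ idealOfVars σ K ^ a := by
  rw [mem_pow_idealOfVars_iff]
  exact fun e he => had.trans (hf.degree_eq_sum_deg_support he).le

/-- The map `P_d → ∏ j, (P / Q j)_d` induced by the projections, where `P` is the polynomial ring:
the degree `d` part of the map in the Chinese remainder theorem. -/
def crtComponent (Q : ι → Ideal (MvPolynomial σ K)) (d : ℕ) :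
    homogeneousSubmodule σ K d →ₗ[K] ∀ j, quotComponent (Q j) d :=
  LinearMap.pi fun j =>
    (Ideal.Quotient.mkₐ K (Q j)).toLinearMap.submoduleMap (homogeneousSubmodule σ K d)

theorem crtComponent_apply_eq_zero_iff {d : ℕ} {f : homogeneousSubmodule σ K d} {j : ι} :
    crtComponent Q d f j = 0 ↔ f.1 ∈ Q j := by
  rw [← Ideal.Quotient.eq_zero_iff_mem, Subtype.ext_iff]
  rfl

variable [Fintype ι] (hQ : ∀ j, (Q j).IsHomogeneous (homogeneousSubmodule σ K)) {a d : ℕ}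
  (ha : Pairwise fun j k => idealOfVars σ K ^ a ≤ Q j ⊔ Q k) (hd : a * Fintype.card ι ≤ d)

include ha hd in
theorem mem_sup_inf_erase_of_isHomogeneous [DecidableEq ι] (j : ι) {f : MvPolynomial σ K}
    (hf : f.IsHomogeneous d) : f ∈ Q j ⊔ (Finset.univ.erase j).inf Q := by
  have h : idealOfVars σ K ^ (a * (Finset.univ.erase j).card) ≤
      Q j ⊔ (Finset.univ.erase j).inf Q := by
    rw [pow_mul, ← Finset.prod_const]
    exact (Finset.prod_le_prod' fun k hk => ha (Finset.ne_of_mem_erase hk).symm).trans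
      (prod_sup_le_sup_inf _ _ _)
  refine h (mem_idealOfVars_pow_of_isHomogeneous hf ?_)
  exact (Nat.mul_le_mul_left a (Finset.card_le_univ _)).trans hd

include hQ ha hd in
theorem surjective_crtComponent : Function.Surjective (crtComponent Q d) := by
  classical
  suffices h : ∀ j v, Pi.single j v ∈ (crtComponent Q d).range by
    refine LinearMap.range_eq_top.1 (eq_top_iff.2 fun v _ => ?_)
    rw [← Finset.univ_sum_single v]
    exact Submodule.sum_mem _ fun j _ => h j (v j)
  rintro j ⟨_, F, hF, rfl⟩
  obtain ⟨u, hu, w, hw, huw⟩ :=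
    Submodule.mem_sup.1 (mem_sup_inf_erase_of_isHomogeneous ha hd j hF)
  refine ⟨⟨homogeneousComponent d w, homogeneousComponent_isHomogeneous d w⟩, funext fun k => ?_⟩
  by_cases hk : k = j
  · subst hk
    rw [Pi.single_eq_same]
    refine Subtype.ext (Ideal.Quotient.eq.2 ?_)
    have h : homogeneousComponent d w - F = -homogeneousComponent d u := by
      rw [← homogeneousComponent_eq_self hF, ← huw, map_add]
      ring
    exact h ▸ (Q k).neg_mem (homogeneousComponent_mem_of_mem (hQ k) hu d)
  · rw [Pi.single_eq_of_ne hk, crtComponent_apply_eq_zero_iff]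
    exact homogeneousComponent_mem_of_mem (hQ k)
      (Finset.inf_le (f := Q) (Finset.mem_erase.2 ⟨hk, Finset.mem_univ k⟩) hw) d

include hQ ha hd in
theorem quotHF_iInf [Finite σ] : quotHF (⨅ j, Q j) d = ∑ j, quotHF (Q j) d := by
  have hker : (crtComponent Q d).ker =
      ((Ideal.Quotient.mkₐ K (⨅ j, Q j)).toLinearMap.submoduleMap
        (homogeneousSubmodule σ K d)).ker := by
    ext f
    rw [LinearMap.mem_ker, LinearMap.mem_ker, funext_iff, Subtype.ext_iff]
    refine (forall_congr' fun j => crtComponent_apply_eq_zero_iff).trans ?_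
    exact Ideal.mem_iInf.symm.trans Ideal.Quotient.eq_zero_iff_mem.symm
  have h := LinearMap.finrank_range_add_finrank_ker (V := homogeneousSubmodule σ K d)
    (V₂ := ∀ j, quotComponent (Q j) d) (crtComponent Q d)
  rw [hker, ← LinearMap.finrank_range_add_finrank_ker
      ((Ideal.Quotient.mkₐ K (⨅ j, Q j)).toLinearMap.submoduleMap (homogeneousSubmodule σ K d)),
    LinearMap.range_eq_top.2 (surjective_crtComponent hQ ha hd),
    LinearMap.range_eq_top.2 (LinearMap.submoduleMap_surjective _ _), finrank_top, finrank_top] at h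
  have : ∀ j, Free K (quotComponent (Q j) d) := fun _ => inferInstance
  exact (Nat.add_right_cancel h).symm.trans (finrank_pi_fintype K)

end ChineseRemainder

section Points

variable {K : Type*} [Field K] {n : ℕ}

theorem isHomogeneous_diffPower_two {I : Ideal (MvPolynomial (Fin (n + 1)) K)}
    (hI : I.IsHomogeneous (homogeneousSubmodule (Fin (n + 1)) K)) :
    (diffPower K I 2).IsHomogeneous (homogeneousSubmodule (Fin (n + 1)) K) := by
  intro d f hf
  rw [mem_diffPower_two_iff] at hf
  change (decomposition.decompose' f d : MvPolynomial (Fin (n + 1)) K) ∈ _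
  rw [decomposition.decompose'_apply, mem_diffPower_two_iff]
  refine ⟨homogeneousComponent_mem_of_mem hI hf.1 d, fun i => ?_⟩
  cases d with
  | zero => simp
  | succ d =>
    rw [← homogeneousComponent_pderiv]
    exact homogeneousComponent_mem_of_mem hI (hf.2 i) d

theorem sq_le_diffPower_two (I : Ideal (MvPolynomial (Fin (n + 1)) K)) :
    I ^ 2 ≤ diffPower K I 2 := by
  rw [pow_two, Ideal.mul_le]
  intro a ha b hb
  rw [mem_diffPower_two_iff]
  refine ⟨I.mul_mem_left _ hb, fun i => ?_⟩
  rw [pderiv_mul]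
  exact I.add_mem (I.mul_mem_left _ hb) (I.mul_mem_right _ ha)

theorem diffPower_iInf {R ι : Type*} [CommRing R] [Algebra K R] (J : ι → Ideal R) (m : ℕ) :
    diffPower K (⨅ j, J j) m = ⨅ j, diffPower K (J j) m := by
  ext f
  rw [Ideal.mem_iInf]
  exact ⟨fun h j δ hδ => Ideal.mem_iInf.1 (h δ hδ) j,
    fun h δ hδ => Ideal.mem_iInf.2 fun j => h j δ hδ⟩

theorem isHomogeneous_pow {σ : Type*} {J : Ideal (MvPolynomial σ K)}
    (hJ : J.IsHomogeneous (homogeneousSubmodule σ K)) (m : ℕ) :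
    (J ^ m).IsHomogeneous (homogeneousSubmodule σ K) := by
  induction m with
  | zero => rw [pow_zero, Ideal.one_eq_top]; exact Ideal.IsHomogeneous.top _
  | succ m ih => rw [pow_succ]; exact ih.mul hJ

theorem isHomogeneous_pointIdeal (q : Projectivization K (Fin (n + 1) → K)) :
    (pointIdeal q).IsHomogeneous (homogeneousSubmodule (Fin (n + 1)) K) :=
  Ideal.homogeneous_span _ _ fun _ hf => hf.1

theorem mem_pointIdeal {q : Projectivization K (Fin (n + 1) → K)} {d : ℕ}
    {f : MvPolynomial (Fin (n + 1)) K} (hf : f.IsHomogeneous d) (h : eval q.rep f = 0) :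
    f ∈ pointIdeal q :=
  Ideal.subset_span ⟨⟨d, hf⟩, h⟩

theorem exists_rep_mul_sub_ne_zero {q r : Projectivization K (Fin (n + 1) → K)} (hqr : q ≠ r) :
    ∃ a b, r.rep a * q.rep b - r.rep b * q.rep a ≠ 0 := by
  contrapose! hqr
  obtain ⟨b, hb⟩ := Function.ne_iff.1 q.rep_nonzero
  have hb : q.rep b ≠ 0 := hb
  rw [eq_comm, ← q.mk_rep, ← r.mk_rep, Projectivization.mk_eq_mk_iff']
  refine ⟨r.rep b / q.rep b, funext fun a => ?_⟩
  rw [Pi.smul_apply, smul_eq_mul, div_mul_eq_mul_div, div_eq_iff hb]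
  exact (sub_eq_zero.1 (hqr a b)).symm

theorem idealOfVars_le_pointIdeal_sup {q r : Projectivization K (Fin (n + 1) → K)} (hqr : q ≠ r) :
    idealOfVars (Fin (n + 1)) K ≤ pointIdeal q ⊔ pointIdeal r := by
  obtain ⟨a, b, hab⟩ := exists_rep_mul_sub_ne_zero hqr
  rw [idealOfVars, Ideal.span_le]
  rintro _ ⟨i, rfl⟩
  set c := r.rep a * q.rep b - r.rep b * q.rep a with hc
  let L : MvPolynomial (Fin (n + 1)) K := C (r.rep a) * X b - C (r.rep b) * X a
  have hL : L.IsHomogeneous 1 :=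
    (isHomogeneous_C_mul_X _ _).sub (isHomogeneous_C_mul_X _ _)
  have hLr : L ∈ pointIdeal r := by
    refine mem_pointIdeal hL ?_
    simp only [L, map_sub, map_mul, eval_C, eval_X]
    ring
  have hLq : C c * X i - C (q.rep i) * L ∈ pointIdeal q := by
    refine mem_pointIdeal (d := 1) ((isHomogeneous_C_mul_X _ _).sub (hL.C_mul _)) ?_
    simp only [L, hc, map_sub, map_mul, eval_C, eval_X]
    ring
  have hcX : C c * X i ∈ pointIdeal q ⊔ pointIdeal r := by
    rw [← sub_add_cancel (C c * X i) (C (q.rep i) * L)]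
    exact add_mem (Ideal.mem_sup_left hLq) (Ideal.mul_mem_left _ _ (Ideal.mem_sup_right hLr))
  exact (Ideal.unit_mul_mem_iff_mem _ (hab.isUnit.map C)).1 hcX

theorem idealOfVars_pow_le_pointIdeal_pow_sup {q r : Projectivization K (Fin (n + 1) → K)}
    (hqr : q ≠ r) (a b : ℕ) :
    idealOfVars (Fin (n + 1)) K ^ (a + b) ≤ pointIdeal q ^ a ⊔ pointIdeal r ^ b :=
  (Ideal.pow_right_mono (idealOfVars_le_pointIdeal_sup hqr) _).trans
    Ideal.sup_pow_add_le_pow_sup_pow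

end Points

section CoordinateChange

theorem mem_map_algEquiv_iff {K A B : Type*} [CommSemiring K] [CommSemiring A] [CommSemiring B]
    [Algebra K A] [Algebra K B] (e : A ≃ₐ[K] B) {J : Ideal A} {x : A} :
    e x ∈ J.map e ↔ x ∈ J := by
  rw [Ideal.mem_map_of_equiv]
  exact ⟨fun ⟨_, hy, h⟩ => e.injective h ▸ hy, fun hx => ⟨x, hx, rfl⟩⟩

theorem IsDiffOp.conj {K A B : Type*} [CommRing K] [CommRing A] [CommRing B] [Algebra K A]
    [Algebra K B] (e : A ≃ₐ[K] B) {m : ℕ} {δ : A →ₗ[K] A} (h : IsDiffOp K A m δ) :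
    IsDiffOp K B m (e.toLinearMap ∘ₗ δ ∘ₗ e.symm.toLinearMap) := by
  induction m generalizing δ with
  | zero =>
    intro f g
    simp [h (e.symm f) (e.symm g)]
  | succ m ih =>
    intro f
    convert! ih (h (e.symm f)) using 1
    ext g
    simp

theorem diffPower_map {K A B : Type*} [CommRing K] [CommRing A] [CommRing B] [Algebra K A]
    [Algebra K B] (e : A ≃ₐ[K] B) (J : Ideal A) (m : ℕ) :
    diffPower K (J.map e) m = (diffPower K J m).map e := by
  ext y
  obtain ⟨x, rfl⟩ := e.surjective y
  rw [mem_map_algEquiv_iff]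
  constructor
  · intro h δ hδ
    simpa [mem_map_algEquiv_iff] using h _ (hδ.conj e)
  · intro h δ hδ
    simpa using Ideal.mem_map_of_mem e (h _ (hδ.conj e.symm))

variable {K σ : Type*} [Field K]

theorem quotHF_map [Finite σ] {e : MvPolynomial σ K ≃ₐ[K] MvPolynomial σ K}
    (he : ∀ f d, (e f).IsHomogeneous d ↔ f.IsHomogeneous d) (J : Ideal (MvPolynomial σ K)) :
    quotHF (J.map e) = quotHF J := by
  funext d
  have h : idealComponent (J.map e) d =
      (idealComponent J d).map (e.toLinearEquiv : MvPolynomial σ K →ₗ[K] MvPolynomial σ K) := by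
    ext y
    obtain ⟨x, rfl⟩ := e.toLinearEquiv.surjective y
    rw [Submodule.map_equiv_eq_comap_symm, Submodule.mem_comap, LinearEquiv.coe_coe,
      LinearEquiv.symm_apply_apply, mem_idealComponent, mem_idealComponent]
    exact and_congr (he x d) (mem_map_algEquiv_iff e)
  have := quotHF_add_finrank_idealComponent (J.map e) d
  rw [h, LinearEquiv.finrank_map_eq, ← quotHF_add_finrank_idealComponent J d] at this
  exact Nat.add_right_cancel this

/-- The substitution `X_i ↦ X_i + c_i X_{i₀}`. -/
def shearHom (i₀ : σ) (c : σ → K) : MvPolynomial σ K →ₐ[K] MvPolynomial σ K :=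
  aeval fun i => X i + C (c i) * X i₀

variable {i₀ : σ} {c : σ → K}

theorem shearHom_X (i : σ) : shearHom i₀ c (X i) = X i + C (c i) * X i₀ :=
  aeval_X _ _

theorem shearHom_comp_shearHom_neg (hc : c i₀ = 0) :
    (shearHom i₀ c).comp (shearHom i₀ (-c)) = AlgHom.id K _ := by
  ext i : 1
  simp [shearHom, hc]

theorem isHomogeneous_shearHom {f : MvPolynomial σ K} {d : ℕ} (hf : f.IsHomogeneous d) :
    (shearHom i₀ c f).IsHomogeneous d := by
  have := hf.aeval (fun i => X i + C (c i) * X i₀)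
    (fun i => (isHomogeneous_X K i).add (isHomogeneous_C_mul_X (c i) i₀))
  rwa [one_mul] at this

/-- The linear change of coordinates `X_i ↦ X_i + c_i X_{i₀}`, where `c_{i₀} = 0`. -/
def shear (hc : c i₀ = 0) : MvPolynomial σ K ≃ₐ[K] MvPolynomial σ K :=
  AlgEquiv.ofAlgHom (shearHom i₀ c) (shearHom i₀ (-c)) (shearHom_comp_shearHom_neg hc) <| by
    simpa using shearHom_comp_shearHom_neg (c := -c) (by simp [hc])

theorem isHomogeneous_shear_iff (hc : c i₀ = 0) (f : MvPolynomial σ K) (d : ℕ) :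
    (shear hc f).IsHomogeneous d ↔ f.IsHomogeneous d :=
  ⟨fun h => (shear hc).symm_apply_apply f ▸ isHomogeneous_shearHom h, isHomogeneous_shearHom⟩

/-- The ideal generated by the variables `X_i` with `i ∈ s`. -/
def varIdeal (K : Type*) {σ : Type*} [Field K] (s : Finset σ) : Ideal (MvPolynomial σ K) :=
  Ideal.span (X '' s)

theorem aeval_smul_of_isHomogeneous {A : Type*} [CommRing A] [Algebra K A] {f : MvPolynomial σ K}
    {d : ℕ} (hf : f.IsHomogeneous d) (t : A) (v : σ → A) :
    aeval (t • v) f = t ^ d * aeval v f := by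
  rw [aeval_def, aeval_def, eval₂_eq, eval₂_eq, Finset.mul_sum]
  refine Finset.sum_congr rfl fun e he => ?_
  simp only [Pi.smul_apply, smul_eq_mul, mul_pow, Finset.prod_mul_distrib]
  have hd : ∑ i ∈ e.support, e i = d := (hf.degree_eq_sum_deg_support he).symm
  rw [Finset.prod_pow_eq_pow_sum, hd]
  ring

theorem mem_of_eval_eq_zero {J : Ideal (MvPolynomial σ K)} {b : σ → K} {g : MvPolynomial σ K}
    (hJ : ∀ i, X i - C (b i) * g ∈ J) {f : MvPolynomial σ K} {d : ℕ}
    (hf : f.IsHomogeneous d) (h : eval b f = 0) : f ∈ J := by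
  have hfg : aeval (g • (C ∘ b) : σ → MvPolynomial σ K) f = 0 := by
    have hb : aeval (C ∘ b) f = (C (eval b f) : MvPolynomial σ K) :=
      aeval_algebraMap_apply (MvPolynomial σ K) b f
    rw [aeval_smul_of_isHomogeneous hf, hb, h, C_0, mul_zero]
  have hmk : (Ideal.Quotient.mkₐ K J).comp (aeval (g • (C ∘ b))) = Ideal.Quotient.mkₐ K J := by
    ext i
    rw [AlgHom.comp_apply, aeval_X, eq_comm, Pi.smul_apply, smul_eq_mul, mul_comm]
    exact Ideal.Quotient.eq.2 (hJ i)
  rw [← Ideal.Quotient.eq_zero_iff_mem]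
  exact (DFunLike.congr_fun hmk f).symm.trans (by rw [AlgHom.comp_apply, hfg, map_zero])

theorem exists_shear_map_varIdeal_eq_pointIdeal {n : ℕ} (q : Projectivization K (Fin (n + 1) → K)) :
    ∃ (i₀ : Fin (n + 1)) (c : Fin (n + 1) → K) (hc : c i₀ = 0),
      (varIdeal K {i₀}ᶜ).map (shear hc) = pointIdeal q := by
  obtain ⟨i₀, hi₀ : q.rep i₀ ≠ 0⟩ := Function.ne_iff.1 q.rep_nonzero
  let c : Fin (n + 1) → K := Function.update (fun i => -(q.rep i / q.rep i₀)) i₀ 0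
  have hX (i) (hi : i ≠ i₀) : shearHom i₀ c (X i) = X i - C (q.rep i / q.rep i₀) * X i₀ := by
    have hc : c i = -(q.rep i / q.rep i₀) := Function.update_of_ne hi _ _
    rw [shearHom_X, hc, C_neg, neg_mul, sub_eq_add_neg]
  refine ⟨i₀, c, Function.update_self .., le_antisymm ?_ (Ideal.span_le.2 ?_)⟩
  · rw [varIdeal, Ideal.map_span, Ideal.span_le]
    rintro _ ⟨_, ⟨i, hi, rfl⟩, rfl⟩
    refine mem_pointIdeal (isHomogeneous_shearHom (isHomogeneous_X K i)) ?_
    refine (congrArg (eval q.rep) (hX i (by simpa using hi))).trans ?_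
    simp [hi₀]
  · rintro f ⟨⟨d, hf⟩, hfq⟩
    refine mem_of_eval_eq_zero (g := C (q.rep i₀)⁻¹ * X i₀) (fun i => ?_) hf hfq
    rw [← mul_assoc, ← C_mul, ← div_eq_mul_inv]
    by_cases hi : i = i₀
    · simp [hi, hi₀]
    · rw [← hX i hi]
      exact Ideal.mem_map_of_mem (shear _) (Ideal.subset_span ⟨i, by simpa using hi, rfl⟩)

theorem exists_quotHF_pointIdeal_pow_eq {n : ℕ} (q : Projectivization K (Fin (n + 1) → K)) :
    ∃ i₀ : Fin (n + 1), ∀ m,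
      quotHF (pointIdeal q ^ m) = quotHF (varIdeal K {i₀}ᶜ ^ m) ∧
      quotHF (diffPower K (pointIdeal q ^ m) 2) =
        quotHF (diffPower K (varIdeal K {i₀}ᶜ ^ m) 2) := by
  obtain ⟨i₀, c, hc, h⟩ := exists_shear_map_varIdeal_eq_pointIdeal q
  refine ⟨i₀, fun m => ?_⟩
  rw [← h, ← Ideal.map_pow, diffPower_map]
  exact ⟨quotHF_map (isHomogeneous_shear_iff hc) _, quotHF_map (isHomogeneous_shear_iff hc) _⟩

end CoordinateChange

section MonomialCount

section

variable {K σ : Type*} [Field K]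

theorem quotHF_eq_ncard [Finite σ] {J : Ideal (MvPolynomial σ K)} {P : (σ →₀ ℕ) → Prop}
    (hJ : ∀ f, f ∈ J ↔ ∀ e ∈ f.support, P e) (d : ℕ) :
    quotHF J d = {e | e.degree = d ∧ ¬ P e}.ncard := by
  have hfin : {e : σ →₀ ℕ | e.degree = d}.Finite :=
    (Finsupp.finite_of_degree_le d).subset fun e he => he.le
  have hrank (s : Set (σ →₀ ℕ)) : finrank K (restrictSupport K s) = s.ncard :=
    finrank_eq_nat_card_basis (basisRestrictSupport K s)
  have hcomp : idealComponent J d = restrictSupport K ({e | e.degree = d} ∩ {e | P e}) := by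
    ext f
    rw [mem_idealComponent, hJ, ← mem_homogeneousSubmodule,
      homogeneousSubmodule_eq_finsupp_supported]
    exact Set.subset_inter_iff.symm
  have := quotHF_add_finrank_idealComponent J d
  rw [hcomp, homogeneousSubmodule_eq_finsupp_supported, hrank] at this
  have hsplit := Set.ncard_inter_add_ncard_sdiff_eq_ncard {e | e.degree = d} {e | P e} hfin
  rw [← hrank {e | e.degree = d}] at hsplit
  exact Nat.add_right_cancel (this.trans (hsplit.symm.trans (add_comm _ _)))

theorem mem_varIdeal_pow_iff {s : Finset σ} {m : ℕ} {f : MvPolynomial σ K} :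
    f ∈ varIdeal K s ^ m ↔ ∀ e ∈ f.support, m ≤ ∑ i ∈ s, e i := by
  classical
  constructor
  · induction m generalizing f with
    | zero => simp
    | succ m ih =>
      intro hf
      rw [pow_succ] at hf
      refine Submodule.mul_induction_on hf (fun g hg h hh e he => ?_) fun g h hg hh e he =>
        (Finset.mem_union.1 (support_add he)).elim (hg e) (hh e)
      obtain ⟨e₁, he₁, e₂, he₂, rfl⟩ := Finset.mem_add.1 (support_mul g h he)
      obtain ⟨i, hi, hie⟩ := mem_ideal_span_X_image.1 hh e₂ he₂
      have h₂ : 1 ≤ ∑ i ∈ s, e₂ i :=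
        (Nat.one_le_iff_ne_zero.2 hie).trans (Finset.single_le_sum (by simp) hi)
      simpa only [Finsupp.add_apply, Finset.sum_add_distrib] using Nat.add_le_add (ih hg e₁ he₁) h₂
  · intro h
    rw [f.as_sum]
    refine Ideal.sum_mem _ fun e he => Ideal.pow_le_pow_right (h e he) ?_
    have hdvd : ∏ i ∈ s, (X i : MvPolynomial σ K) ^ e i ∣ monomial e (coeff e f) := by
      rw [monomial_eq, Finsupp.prod_of_support_subset e Finset.subset_union_left _ (by simp)]
      exact (Finset.prod_dvd_prod_of_subset _ _ _ Finset.subset_union_right).mul_left _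
    refine Ideal.mem_of_dvd _ hdvd ?_
    rw [← Finset.prod_pow_eq_pow_sum]
    exact Ideal.prod_mem_prod fun i hi => Ideal.pow_mem_pow
      (Ideal.subset_span (Set.mem_image_of_mem X hi)) _

end

variable {K : Type*} [Field K] {n : ℕ}

theorem mem_diffPower_varIdeal_pow_iff {s : Finset (Fin (n + 1))} {m : ℕ}
    {f : MvPolynomial (Fin (n + 1)) K} :
    f ∈ diffPower K (varIdeal K s ^ m) 2 ↔ ∀ e ∈ f.support, m ≤ ∑ i ∈ s, e i ∧
      (∑ i ∈ s, e i = m → ∀ i ∈ s, (e i : K) = 0) := by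
  have hadd (e : Fin (n + 1) →₀ ℕ) (i : Fin (n + 1)) :
      ∑ k ∈ s, (e + .single i 1 : Fin (n + 1) →₀ ℕ) k = ∑ k ∈ s, e k + if i ∈ s then 1 else 0 := by
    simp [Finset.sum_add_distrib, Finsupp.single_apply]
  simp only [mem_diffPower_two_iff, mem_varIdeal_pow_iff]
  constructor
  · rintro ⟨hf, hf'⟩ e he
    refine ⟨hf e he, fun hem i hi => ?_⟩
    by_contra hne
    obtain ⟨e, rfl⟩ : ∃ e', e = e' + Finsupp.single i 1 :=
      ⟨_, (tsub_add_cancel_of_le (Finsupp.single_le_iff.2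
        (Nat.one_le_iff_ne_zero.2 fun h => hne (by rw [h, Nat.cast_zero])))).symm⟩
    have hmem : e ∈ (pderiv i f).support := by
      rw [MvPolynomial.mem_support_iff, coeff_pderiv]
      exact mul_ne_zero (MvPolynomial.mem_support_iff.1 he) (by simpa using hne)
    have := hf' i e hmem
    rw [hadd, if_pos hi] at hem
    omega
  · intro h
    refine ⟨fun e he => (h e he).1, fun i e he => ?_⟩
    rw [MvPolynomial.mem_support_iff, coeff_pderiv] at he
    obtain ⟨hle, heq⟩ := h _ (MvPolynomial.mem_support_iff.2 (left_ne_zero_of_mul he))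
    rw [hadd] at hle heq
    split_ifs at hle heq with hi
    · by_contra hlt
      exact right_ne_zero_of_mul he (by simpa using heq (by omega) i hi)
    · exact hle

theorem sum_compl_singleton_eq (i₀ : Fin (n + 1)) (e : Fin (n + 1) → ℕ) :
    ∑ i ∈ {i₀}ᶜ, e i = ∑ k, e (i₀.succAbove k) := by
  rw [← Fin.image_succAbove_univ, Finset.sum_image Fin.succAbove_right_injective.injOn]

theorem degree_eq_add_sum_succAbove (i₀ : Fin (n + 1)) (e : Fin (n + 1) →₀ ℕ) :
    e.degree = e i₀ + ∑ k, e (i₀.succAbove k) := by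
  rw [Finsupp.degree_eq_sum, Fin.sum_univ_succAbove _ i₀]

theorem ncard_degree_eq_and_mem {S : Set (Fin n → ℕ)} {d : ℕ} (i₀ : Fin (n + 1))
    (hS : ∀ α ∈ S, ∑ k, α k ≤ d) :
    {e : Fin (n + 1) →₀ ℕ | e.degree = d ∧ (fun k => e (i₀.succAbove k)) ∈ S}.ncard = S.ncard := by
  refine Set.ncard_congr (fun e _ k => e (i₀.succAbove k)) (fun e he => he.2) ?_ ?_
  · rintro e e' ⟨he, -⟩ ⟨he', -⟩ h
    rw [degree_eq_add_sum_succAbove i₀] at he he'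
    refine Finsupp.ext ((Fin.forall_iff_succAbove i₀).2 ⟨?_, congrFun h⟩)
    have := congrArg (fun α => ∑ k, α k) h
    dsimp only at this
    omega
  · intro α hα
    refine ⟨Finsupp.equivFunOnFinite.symm (i₀.insertNth (d - ∑ k, α k) α), ⟨?_, ?_⟩, ?_⟩
    · simpa [degree_eq_add_sum_succAbove i₀] using Nat.sub_add_cancel (hS α hα)
    · simpa using hα
    · simp

theorem ncard_sum_lt (n : ℕ) {m : ℕ} (hm : 1 ≤ m) :
    {α : Fin n → ℕ | ∑ k, α k < m}.ncard = (m + n - 1).choose n := by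
  obtain ⟨m, rfl⟩ := Nat.exists_eq_add_of_le' hm
  have heq : {e : Fin (n + 1) →₀ ℕ | e.degree = m ∧
        (fun k => e (Fin.succAbove 0 k)) ∈ {α : Fin n → ℕ | ∑ k, α k < m + 1}} =
      ((Finset.univ.finsuppAntidiag m : Finset (Fin (n + 1) →₀ ℕ)) : Set _) := by
    ext e
    have := degree_eq_add_sum_succAbove 0 e
    simp only [Set.mem_ofPred_eq, Finset.mem_coe, Finset.mem_finsuppAntidiag, Finset.subset_univ,
      and_true, ← Finsupp.degree_eq_sum]
    omega
  have hle : ∀ α ∈ {α : Fin n → ℕ | ∑ k, α k < m + 1}, ∑ k, α k ≤ m := fun α =>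
    Nat.le_of_lt_succ
  rw [← ncard_degree_eq_and_mem 0 hle, heq, Set.ncard_coe_finset,
    Finset.card_finsuppAntidiag_nat_eq_choose, Finset.card_univ, Fintype.card_fin,
    Nat.add_right_comm, Nat.add_sub_cancel, ← Nat.choose_symm_add, Nat.add_right_comm,
    Nat.add_sub_cancel, Nat.add_comm]

theorem ncard_sum_eq_and_forall_dvd (n p : ℕ) {m : ℕ} (hm : 1 ≤ m) :
    {α : Fin n → ℕ | ∑ k, α k = m ∧ ∀ k, p ∣ α k}.ncard =
      if p ∣ m then {α : Fin n → ℕ | ∑ k, α k = m / p}.ncard else 0 := by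
  split_ifs with hp
  · have hp₀ : 0 < p := Nat.pos_of_dvd_of_pos hp hm
    have himage : {α : Fin n → ℕ | ∑ k, α k = m ∧ ∀ k, p ∣ α k} =
        (fun (α : Fin n → ℕ) k => p * α k) '' {α | ∑ k, α k = m / p} := by
      ext α
      constructor
      · rintro ⟨rfl, hα⟩
        exact ⟨fun k => α k / p, (Nat.sum_div fun k _ => hα k).symm,
          funext fun k => Nat.mul_div_cancel' (hα k)⟩
      · rintro ⟨β, hβ : ∑ k, β k = m / p, rfl⟩
        exact ⟨by rw [← Finset.mul_sum, hβ, Nat.mul_div_cancel' hp], fun k => dvd_mul_right _ _⟩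
    rw [himage, Set.ncard_image_of_injective]
    exact fun α β h => funext fun k => Nat.eq_of_mul_eq_mul_left hp₀ (congrFun h k)
  · have hempty : {α : Fin n → ℕ | ∑ k, α k = m ∧ ∀ k, p ∣ α k} = ∅ :=
      Set.eq_empty_of_forall_notMem fun α hα => hp (hα.1 ▸ Finset.dvd_sum fun k _ => hα.2 k)
    rw [hempty, Set.ncard_empty]

theorem quotHF_varIdeal_pow (i₀ : Fin (n + 1)) {m d : ℕ} (hm : 1 ≤ m) (hmd : m ≤ d) :
    quotHF (varIdeal K {i₀}ᶜ ^ m) d = (m + n - 1).choose n := by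
  rw [quotHF_eq_ncard fun f => mem_varIdeal_pow_iff]
  simp only [sum_compl_singleton_eq, not_le]
  exact (ncard_degree_eq_and_mem (S := {α | ∑ k, α k < m}) i₀ fun α hα =>
    (Set.mem_ofPred.1 hα).le.trans hmd).trans (ncard_sum_lt n hm)

theorem quotHF_diffPower_varIdeal_pow (p : ℕ) [CharP K p] (i₀ : Fin (n + 1)) {m d : ℕ}
    (hm : 1 ≤ m) (hmd : m ≤ d) :
    quotHF (diffPower K (varIdeal K {i₀}ᶜ ^ m) 2) d +
      (if p ∣ m then {α : Fin n → ℕ | ∑ k, α k = m / p}.ncard else 0) = (m + n).choose n := by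
  let S : Set (Fin n → ℕ) := {α | ∑ k, α k < m + 1}
  let T : Set (Fin n → ℕ) := {α | ∑ k, α k = m ∧ ∀ k, p ∣ α k}
  have hS : S.ncard = (m + n).choose n := by
    rw [ncard_sum_lt n (Nat.le_add_left 1 m), Nat.add_right_comm, Nat.add_sub_cancel]
  have hTS : T ⊆ S := fun α hα => hα.1.trans_lt (Nat.lt_succ_self m)
  have hcount : quotHF (diffPower K (varIdeal K {i₀}ᶜ ^ m) 2) d = (S \ T).ncard := by
    rw [quotHF_eq_ncard fun f => mem_diffPower_varIdeal_pow_iff,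
      ← ncard_degree_eq_and_mem (S := S \ T) i₀ fun α hα => (Nat.le_of_lt_succ hα.1).trans hmd]
    congr! 3 with e
    have hcast : (∀ i ∈ ({i₀}ᶜ : Finset _), (e i : K) = 0) ↔ ∀ k, p ∣ e (i₀.succAbove k) := by
      simp [Fin.forall_iff_succAbove i₀, CharP.cast_eq_zero_iff K p]
    rw [hcast, sum_compl_singleton_eq, Set.mem_sdiff, Set.mem_ofPred_eq, Set.mem_ofPred_eq]
    grind
  rw [hcount, ← ncard_sum_eq_and_forall_dvd n p hm]
  have hfin : S.Finite := Set.finite_of_ncard_pos (hS ▸ Nat.choose_pos (Nat.le_add_left n m))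
  rw [Set.ncard_sdiff_add_ncard_of_subset hTS hfin, hS]

end MonomialCount

section FatPoints

section

variable {K : Type*} [Field K] {n : ℕ}

theorem eventually_quotHF_iInf {σ ι : Type*} [Finite σ] [Fintype ι]
    {Q : ι → Ideal (MvPolynomial σ K)} {a : ℕ} {D : ι → ℕ}
    (hQ : ∀ j, (Q j).IsHomogeneous (homogeneousSubmodule σ K))
    (ha : Pairwise fun j k => idealOfVars σ K ^ a ≤ Q j ⊔ Q k)
    (hD : ∀ j, ∀ᶠ d in atTop, quotHF (Q j) d = D j) :
    ∀ᶠ d in atTop, quotHF (⨅ j, Q j) d = ∑ j, D j := by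
  filter_upwards [eventually_all.2 hD, eventually_ge_atTop (a * Fintype.card ι)] with d hd had
  rw [quotHF_iInf hQ ha had]
  exact Finset.sum_congr rfl fun j _ => hd j

theorem eventually_quotHF_pointIdeal_pow (q : Projectivization K (Fin (n + 1) → K)) {m : ℕ}
    (hm : 1 ≤ m) : ∀ᶠ d in atTop, quotHF (pointIdeal q ^ m) d = (m + n - 1).choose n := by
  obtain ⟨i₀, h⟩ := exists_quotHF_pointIdeal_pow_eq q
  filter_upwards [eventually_ge_atTop m] with d hd
  rw [(h m).1, quotHF_varIdeal_pow i₀ hm hd]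

theorem exists_eventually_quotHF_diffPower_pointIdeal_pow (p : ℕ) [CharP K p]
    (q : Projectivization K (Fin (n + 1) → K)) {m : ℕ} (hm : 1 ≤ m) :
    ∃ D, (∀ᶠ d in atTop, quotHF (diffPower K (pointIdeal q ^ m) 2) d = D) ∧
      D + (if p ∣ m then {α : Fin n → ℕ | ∑ k, α k = m / p}.ncard else 0) = (m + n).choose n := by
  obtain ⟨i₀, h⟩ := exists_quotHF_pointIdeal_pow_eq q
  refine ⟨_, ?_, quotHF_diffPower_varIdeal_pow (K := K) p i₀ hm le_rfl⟩
  filter_upwards [eventually_ge_atTop m] with d hd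
  rw [(h m).2]
  exact Nat.add_right_cancel ((quotHF_diffPower_varIdeal_pow p i₀ hm hd).trans
    (quotHF_diffPower_varIdeal_pow p i₀ hm le_rfl).symm)

theorem pairwise_idealOfVars_pow_le_sup {ι : Type*} {q : ι → Projectivization K (Fin (n + 1) → K)}
    (hq : Function.Injective q) {Q : ι → Ideal (MvPolynomial (Fin (n + 1)) K)} {a : ℕ}
    (hQ : ∀ j, pointIdeal (q j) ^ a ≤ Q j) :
    Pairwise fun j k => idealOfVars (Fin (n + 1)) K ^ (a + a) ≤ Q j ⊔ Q k := fun j k hjk =>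
  (idealOfVars_pow_le_pointIdeal_pow_sup (hq.ne hjk) a a).trans (sup_le_sup (hQ j) (hQ k))

theorem mul_choose_sub_choose_one (n : ℕ) :
    ((n : ℚ) + 2) * ((1 + n - 1).choose n : ℚ) - ((1 + n).choose n : ℚ) = 1 := by
  rw [Nat.add_sub_cancel_left, Nat.choose_self, Nat.add_comm, Nat.choose_succ_self_right]
  push_cast
  ring

theorem one_lt_mul_choose_sub_choose {n m : ℕ} (hn : 1 ≤ n) (hm : 2 ≤ m) :
    1 < ((n : ℚ) + 2) * ((m + n - 1).choose n : ℚ) - ((m + n).choose n : ℚ) := by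
  obtain ⟨k, rfl⟩ := Nat.exists_eq_add_of_le' (Nat.one_le_of_lt hm)
  have hrec : ((k + 1 + n).choose n : ℚ) * (k + 1) = (k + n).choose n * (k + n + 1) := by
    have := Nat.add_one_mul_choose_eq (k + n) k
    rw [Nat.choose_symm_add, Nat.add_right_comm, Nat.choose_symm_add] at this
    rw [← Nat.cast_add_one, ← Nat.cast_mul, ← this]
    push_cast
    ring
  rw [show k + 1 + n - 1 = k + n by omega]
  have hpos : (1 : ℚ) ≤ (k + n).choose n := by
    exact_mod_cast Nat.choose_pos (Nat.le_add_left n k)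
  have hnk : (1 : ℚ) ≤ n * k := by exact_mod_cast Nat.mul_pos hn (by omega : 0 < k)
  refine lt_of_mul_lt_mul_right ?_ (by positivity : (0 : ℚ) ≤ k + 1)
  calc 1 * ((k : ℚ) + 1) < 1 * (n * k + k + 1) := by linarith
    _ ≤ (k + n).choose n * (n * k + k + 1) := by gcongr
    _ = _ := by linear_combination hrec

end

namespace ZeroDimScheme

variable {K : Type*} [Field K] {n s : ℕ} {𝕏 : ZeroDimScheme K n}
  {q : Fin s → Projectivization K (Fin (n + 1) → K)} {m : Fin s → ℕ}

theorem degree_eq_of_isFatPointScheme (h : IsFatPointScheme 𝕏 q m) :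
    𝕏.degree = ∑ j, ((m j + n - 1).choose n : ℚ) := by
  have hle (j) : pointIdeal (q j) ^ (∑ k, m k) ≤ pointIdeal (q j) ^ m j :=
    Ideal.pow_le_pow_right (Finset.single_le_sum_of_canonicallyOrdered (Finset.mem_univ j))
  have hdeg : 𝕏.degree = ((∑ j, (m j + n - 1).choose n : ℕ) : ℚ) := by
    refine degree_eq_of_eventually _ ?_
    rw [h.ideal_eq]
    exact eventually_quotHF_iInf (fun j => isHomogeneous_pow (isHomogeneous_pointIdeal (q j)) (m j))
      (pairwise_idealOfVars_pow_le_sup h.distinct hle)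
      fun j => eventually_quotHF_pointIdeal_pow _ (h.pos j)
  rw [hdeg, Nat.cast_sum]

theorem degree_diffFattening_of_isFatPointScheme (p : ℕ) [CharP K p]
    (h : IsFatPointScheme 𝕏 q m) :
    𝕏.diffFattening.degree + ∑ j with p ∣ m j, ({α : Fin n → ℕ | ∑ i, α i = m j / p}.ncard : ℚ) =
      ∑ j, ((m j + n).choose n : ℚ) := by
  choose D hD hDm using fun j =>
    exists_eventually_quotHF_diffPower_pointIdeal_pow p (q j) (h.pos j)
  have hideal : 𝕏.diffFattening.ideal = ⨅ j, diffPower K (pointIdeal (q j) ^ m j) 2 := by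
    rw [← diffPower_iInf, ← h.ideal_eq]
    rfl
  have hle (j) : pointIdeal (q j) ^ (∑ k, m k * 2) ≤ diffPower K (pointIdeal (q j) ^ m j) 2 :=
    calc pointIdeal (q j) ^ (∑ k, m k * 2) ≤ pointIdeal (q j) ^ (m j * 2) :=
          Ideal.pow_le_pow_right <|
            Finset.single_le_sum_of_canonicallyOrdered (f := fun k => m k * 2) (Finset.mem_univ j)
      _ = (pointIdeal (q j) ^ m j) ^ 2 := pow_mul ..
      _ ≤ _ := sq_le_diffPower_two _
  have hdeg : 𝕏.diffFattening.degree = ((∑ j, D j : ℕ) : ℚ) := by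
    refine degree_eq_of_eventually _ ?_
    rw [hideal]
    exact eventually_quotHF_iInf
      (fun j => isHomogeneous_diffPower_two <|
        isHomogeneous_pow (isHomogeneous_pointIdeal (q j)) (m j))
      (pairwise_idealOfVars_pow_le_sup h.distinct hle) hD
  rw [hdeg, Finset.sum_filter, Nat.cast_sum, ← Finset.sum_add_distrib]
  refine Finset.sum_congr rfl fun j _ => ?_
  rw [← hDm j]
  push_cast
  rfl

theorem hilbertPoly_HFOmega_of_isFatPointScheme (p : ℕ) [CharP K p]
    (h : IsFatPointScheme 𝕏 q m) :
    hilbertPoly 𝕏.HFOmega = Polynomial.C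
      (∑ j, (((n : ℚ) + 2) * ((m j + n - 1).choose n : ℚ) - ((m j + n).choose n : ℚ)) +
        ∑ j with p ∣ m j, ({α : Fin n → ℕ | ∑ i, α i = m j / p}.ncard : ℚ)) := by
  rw [𝕏.isHilbertPoly_HFOmega.hilbertPoly_eq, Finset.sum_sub_distrib, ← Finset.mul_sum,
    ← degree_eq_of_isFatPointScheme h, ← degree_diffFattening_of_isFatPointScheme p h]
  congr 1
  ring

theorem forall_eq_one_iff_of_isFatPointScheme (p : ℕ) [CharP K p]
    (h : IsFatPointScheme 𝕏 q m) (hn : 1 ≤ n) :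
    (∀ j, m j = 1) ↔ hilbertPoly 𝕏.HFOmega = Polynomial.C (s : ℚ) := by
  have hs : (s : ℚ) = ∑ _j : Fin s, 1 := by simp
  rw [hilbertPoly_HFOmega_of_isFatPointScheme p h, Polynomial.C_inj, hs]
  constructor
  · intro hm
    have hp : ∀ j ∈ Finset.univ, ¬ p ∣ m j := fun j _ => by
      rw [hm j, Nat.dvd_one]
      exact CharP.char_ne_one K p
    rw [Finset.filter_false_of_mem hp, Finset.sum_empty, add_zero]
    exact Finset.sum_congr rfl fun j _ => by rw [hm j, mul_choose_sub_choose_one]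
  · intro heq
    have hlt (j) (hj : m j ≠ 1) := one_lt_mul_choose_sub_choose hn
      (Nat.lt_of_le_of_ne (h.pos j) (Ne.symm hj))
    have hle : ∀ j ∈ Finset.univ, (1 : ℚ) ≤
        ((n : ℚ) + 2) * ((m j + n - 1).choose n : ℚ) - ((m j + n).choose n : ℚ) := fun j _ => by
      by_cases hj : m j = 1
      · rw [hj, mul_choose_sub_choose_one]
      · exact (hlt j hj).le
    have hcorr : (0 : ℚ) ≤
        ∑ j with p ∣ m j, ({α : Fin n → ℕ | ∑ i, α i = m j / p}.ncard : ℚ) := by positivity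
    have hsum := (Finset.sum_le_sum hle).antisymm (heq ▸ le_add_of_nonneg_right hcorr)
    intro j
    by_contra hj
    exact (hlt j hj).ne ((Finset.sum_eq_sum_iff_of_le hle).1 hsum j (Finset.mem_univ j))

end ZeroDimScheme

end FatPoints

end

theorem corollary3p9_general {K : Type*} [Field K] {n : ℕ} (X : ZeroDimScheme K n) :
    (∀ i : ℕ, X.HFOmega i = (n + 1) * X.HF (i - 1) + X.HF i - X.diffFattening.HF i) ∧
    (IsHilbertPoly X.HF (Polynomial.C X.degree) ∧
      IsHilbertPoly X.diffFattening.HF (Polynomial.C X.diffFattening.degree) ∧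
      IsHilbertPoly X.HFOmega (hilbertPoly X.HFOmega)) ∧
    hilbertPoly X.HFOmega = Polynomial.C ((n + 2) * X.degree - X.diffFattening.degree) ∧
    (IsLeast (regularitySet X.HF) (regularityIndex X.HF) ∧
      IsLeast (regularitySet X.diffFattening.HF) (regularityIndex X.diffFattening.HF) ∧
      IsLeast (regularitySet X.HFOmega) (regularityIndex X.HFOmega)) ∧
    regularityIndex X.HFOmega ≤
      max (regularityIndex X.HF + 1) (regularityIndex X.diffFattening.HF) ∧
    (∀ (p : ℕ) [CharP K p] (s : ℕ) (q : Fin s → Projectivization K (Fin (n + 1) → K))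
      (m : Fin s → ℕ), IsFatPointScheme X q m →
        hilbertPoly X.HFOmega = Polynomial.C
          (∑ j, (((n : ℚ) + 2) * ((m j + n - 1).choose n : ℚ) - ((m j + n).choose n : ℚ)) +
            ∑ j with p ∣ m j, ({α : Fin n → ℕ | ∑ i, α i = m j / p}.ncard : ℚ)) ∧
        (1 ≤ n → ((∀ j, m j = 1) ↔ hilbertPoly X.HFOmega = Polynomial.C (s : ℚ)))) := by
  have hΩ := X.isHilbertPoly_HFOmega
  refine ⟨X.HFOmega_natCast, ⟨X.isHilbertPoly_HF, X.diffFattening.isHilbertPoly_HF, ?_⟩,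
    hΩ.hilbertPoly_eq, ⟨X.isLeast_regularityIndex_HF, X.diffFattening.isLeast_regularityIndex_HF,
      X.isLeast_regularityIndex_HFOmega⟩, X.regularityIndex_HFOmega_le, ?_⟩
  · rwa [hΩ.hilbertPoly_eq]
  · intro p _ s q m h
    exact ⟨ZeroDimScheme.hilbertPoly_HFOmega_of_isFatPointScheme p h,
      ZeroDimScheme.forall_eq_one_iff_of_isFatPointScheme p h⟩

theorem corollary3p9 {K : Type*} [Field K] [PerfectField K] {n : ℕ} (X : ZeroDimScheme K n) :
    -- the Hilbert function of the module of differentials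
    (∀ i : ℕ, X.HFOmega i = (n + 1) * X.HF (i - 1) + X.HF i - X.diffFattening.HF i) ∧
    -- the Hilbert polynomials exist, and those of the two schemes are constants, their degrees
    (IsHilbertPoly X.HF (Polynomial.C X.degree) ∧
      IsHilbertPoly X.diffFattening.HF (Polynomial.C X.diffFattening.degree) ∧
      IsHilbertPoly X.HFOmega (hilbertPoly X.HFOmega)) ∧
    hilbertPoly X.HFOmega = Polynomial.C ((n + 2) * X.degree - X.diffFattening.degree) ∧
    -- the regularity indices are attained
    (IsLeast (regularitySet X.HF) (regularityIndex X.HF) ∧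
      IsLeast (regularitySet X.diffFattening.HF) (regularityIndex X.diffFattening.HF) ∧
      IsLeast (regularitySet X.HFOmega) (regularityIndex X.HFOmega)) ∧
    regularityIndex X.HFOmega ≤
      max (regularityIndex X.HF + 1) (regularityIndex X.diffFattening.HF) ∧
    -- fat point schemes
    (∀ (p : ℕ) [CharP K p] (s : ℕ) (q : Fin s → Projectivization K (Fin (n + 1) → K))
      (m : Fin s → ℕ), IsFatPointScheme X q m →
        hilbertPoly X.HFOmega = Polynomial.C
          (∑ j, (((n : ℚ) + 2) * ((m j + n - 1).choose n : ℚ) - ((m j + n).choose n : ℚ)) +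
            ∑ j with p ∣ m j, ({α : Fin n → ℕ | ∑ i, α i = m j / p}.ncard : ℚ)) ∧
        (1 ≤ n → ((∀ j, m j = 1) ↔ hilbertPoly X.HFOmega = Polynomial.C (s : ℚ)))) :=
  corollary3p9_general X
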